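/- All algebraic groups are linear, given as closed subgroups of some $\mathrm{SL}_n$. For a connected algebraic group $\mathbb G\subset \mathrm{SL}_n$ over a number field $K$ and a finite set $S$ of places of $K$ containing the set $S_\infty$ of infinite places, let $\mathcal O(S)=\{x\in K : \|x\|_v\le 1 \text{ for all places } v\notin S\}$, let $K_v$ be the completion of $K$ at $v$, let $\mathbb G_\infty=\prod_{v\in S_\infty}\mathbb G_{K_v}$ and $\mathbb G_S=\prod_{v\in S}\mathbb G_{K_v}$ (in which $\mathbb G_{\mathcal O(S)}$ is embedded diagonally), and put $$\mathbb G_S^{*}=\Bigl\{x\in\mathbb G_S : \prod_{v\in S}\|\chi(x_v)\|_v=1\text{ for all } K\text{-characters }\chi\text{ of }\mathbb G\Bigr\},$$ $$\mathbb G_S^{\circ}=\bigl\{x\in\mathbb G_S^{*} : \mathrm{Ad}_{\mathbb G_\infty}x\in\overline{\mathrm{Ad}_{\mathbb G_\infty}\mathbb G_{\mathcal O(S)}}\bigr\},$$ where $\|\cdot\|_v$ are the normalized absolute values, $\mathrm{Ad}_{\mathbb G_\infty}$ is the adjoint representation of the real Lie group $\mathbb G_\infty$ on its Lie algebra (composed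 with the projection $\mathbb G_S\to\mathbb G_\infty$), and the bar denotes the almost-Zariski closure: the smallest subgroup $A$ containing the given one for which there is a real Zariski-closed subgroup $B$ with $B^\circ\subset A\subset B$, with $B^\circ$ the identity component of $B$ in the Lie group topology. Let $p$ and $q$ be distinct primes with $q\equiv 3\pmod 4$, let $K=\mathbb Q(i,\sqrt p)$ with ring of integers $\mathcal O=\mathcal O(S_\infty)$, and let $\mathbb T=\mathrm{SO}(x^2+qy^2)$, the group of all $g\in\mathrm{SL}_2$ that preserve the form $x^2+qy^2$. Then: (1) $\mathbb T$ is a $K$-anisotropic torus, and $\mathbb T_{\mathcal O}$ is not Zariski dense in $\mathbb T_\infty$, where $\mathbb T_\infty$ carries the real Zariski topology obtained by restricting scalars from $K_v$ to $\mathbb R$. (2) Consequently $\mathbb G_S^\circ$ can be a proper subgroup of $\mathbb G_S^*$ even when $\mathbb G_{\mathcal O(S)}$ is Zariski dense in $\mathbb G$: with $S=S_\infty$, there is a connected algebraic group $\mathbb G$ over $K$ that is a semidirect product $\mathbb G=\mathbb T\ltimes\mathbb U$ with $\mathbb U$ unipotent and $C_{\mathbb T}(\mathbb U)$ trivial, such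 that $\mathbb G_{\mathcal O(S)}$ is Zariski dense in $\mathbb G$ and $\mathbb G_S^\circ\subsetneq\mathbb G_S^*$. -/

import Mathlib

open NumberField IsDedekindDomain

universe u

/-! ### Zariski topology in coordinates

`c : X → σ → k` is a system of coordinates on `X`. -/

namespace Zariski

variable {X σ k : Type*} [CommRing k]

/-- Zariski closed subsets of `X`: the zero loci of sets of polynomials in the coordinates. -/
def IsClosed (c : X → σ → k) (Z : Set X) : Prop :=
  ∃ P : Set (MvPolynomial σ k), Z = {x | ∀ f ∈ P, MvPolynomial.eval (c x) f = 0}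

/-- The subset `A` of `B` is Zariski dense in `B`: every Zariski closed set that contains `A`
contains `B`. -/
def DenseIn (c : X → σ → k) (A B : Set X) : Prop :=
  ∀ Z, IsClosed c Z → A ⊆ Z → B ⊆ Z

/-- `B` is connected in the (subspace) Zariski topology. -/
def Connected (c : X → σ → k) (B : Set X) : Prop :=
  B.Nonempty ∧ ∀ Z W, IsClosed c Z → IsClosed c W → B ⊆ Z ∪ W → B ∩ Z ∩ W = ∅ →
    B ⊆ Z ∨ B ⊆ W

end Zariski

/-- The entries of a matrix, as coordinates. -/
def entries {n : ℕ} {A : Type*} (g : Matrix (Fin n) (Fin n) A) : Fin n × Fin n → A :=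
  fun ij => g ij.1 ij.2

/-! ### Linear algebraic groups -/

/-- A linear algebraic group over the field `K` inside `SL_n`: a set of polynomial equations over
`K` in the matrix entries whose solutions in `SL_n(A)` form a subgroup, for all commutative
`K`-algebras `A` (that is, a closed `K`-subgroup scheme of `SL_n`). -/
structure LinAlgGroup (K : Type u) [Field K] (n : ℕ) where
  eqns : Set (MvPolynomial (Fin n × Fin n) K)
  one_mem' : ∀ (A : Type u) [CommRing A] [Algebra K A], ∀ f ∈ eqns,
    MvPolynomial.aeval (entries (1 : Matrix (Fin n) (Fin n) A)) f = 0
  mul_mem' : ∀ (A : Type u) [CommRing A] [Algebra K A]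
    (g h : Matrix.SpecialLinearGroup (Fin n) A),
    (∀ f ∈ eqns, MvPolynomial.aeval (entries g.1) f = 0) →
    (∀ f ∈ eqns, MvPolynomial.aeval (entries h.1) f = 0) →
    ∀ f ∈ eqns, MvPolynomial.aeval (entries (g * h).1) f = 0
  inv_mem' : ∀ (A : Type u) [CommRing A] [Algebra K A]
    (g : Matrix.SpecialLinearGroup (Fin n) A),
    (∀ f ∈ eqns, MvPolynomial.aeval (entries g.1) f = 0) →
    ∀ f ∈ eqns, MvPolynomial.aeval (entries (g⁻¹).1) f = 0

namespace LinAlgGroup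

section Field

variable {K : Type u} [Field K] {n m : ℕ}

/-- The group `G(A)` of points of `G` in a commutative `K`-algebra `A`. -/
def points (G : LinAlgGroup K n) (A : Type u) [CommRing A] [Algebra K A] :
    Subgroup (Matrix.SpecialLinearGroup (Fin n) A) where
  carrier := {g | ∀ f ∈ G.eqns, MvPolynomial.aeval (entries g.1) f = 0}
  one_mem' := G.one_mem' A
  mul_mem' {g h} hg hh := G.mul_mem' A g h hg hh
  inv_mem' {g} hg := G.inv_mem' A g hg

theorem map_mem_points (G : LinAlgGroup K n) {A B : Type u} [CommRing A] [Algebra K A]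
    [CommRing B] [Algebra K B] (φ : A →ₐ[K] B) {g : Matrix.SpecialLinearGroup (Fin n) A}
    (hg : g ∈ G.points A) :
    Matrix.SpecialLinearGroup.map (φ : A →+* B) g ∈ G.points B := by
  intro f hf
  have h := congrArg φ (hg f hf)
  rw [map_zero] at h
  rw [← h, ← AlgHom.comp_apply, MvPolynomial.comp_aeval]
  rfl

/-- Functoriality `G(A) → G(B)` of points. -/
def pointsMap (G : LinAlgGroup K n) {A B : Type u} [CommRing A] [Algebra K A]
    [CommRing B] [Algebra K B] (φ : A →ₐ[K] B) : G.points A →* G.points B :=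
  ((Matrix.SpecialLinearGroup.map (φ : A →+* B)).comp (G.points A).subtype).codRestrict
    (G.points B) fun g => G.map_mem_points φ g.2

/-- `G` is connected: `G(K̄)` is connected in the Zariski topology. -/
def IsConnected (G : LinAlgGroup K n) : Prop :=
  Zariski.Connected (fun g : Matrix.SpecialLinearGroup (Fin n) (AlgebraicClosure K) => entries g.1)
    (G.points (AlgebraicClosure K))

/-- `G` is unipotent. -/
def IsUnipotent (G : LinAlgGroup K n) : Prop :=
  ∀ g ∈ G.points (AlgebraicClosure K), IsNilpotent (g.1 - 1)

/-- `G` is a torus: it is connected and diagonalizable over the algebraic closure. -/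
def IsTorus (G : LinAlgGroup K n) : Prop :=
  G.IsConnected ∧ ∃ P : GL (Fin n) (AlgebraicClosure K),
    ∀ g ∈ G.points (AlgebraicClosure K), (P.1 * g.1 * (P⁻¹).1).IsDiag

/-- A regular function on `G ⊆ SL_n`, given by a polynomial over `K` in the matrix entries,
is a `K`-character `G → GL_1` if it is multiplicative. -/
def IsCharacter (G : LinAlgGroup K n) (χ : MvPolynomial (Fin n × Fin n) K) : Prop :=
  ∀ (A : Type u) [CommRing A] [Algebra K A],
    MvPolynomial.aeval (entries (1 : Matrix (Fin n) (Fin n) A)) χ = 1 ∧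
    ∀ g ∈ G.points A, ∀ h ∈ G.points A,
      MvPolynomial.aeval (entries (g * h).1) χ =
        MvPolynomial.aeval (entries g.1) χ * MvPolynomial.aeval (entries h.1) χ

/-- `G` has no nontrivial `K`-characters; for a torus, this says that `G` is `K`-anisotropic. -/
def IsAnisotropic (G : LinAlgGroup K n) : Prop :=
  ∀ χ, G.IsCharacter χ → ∀ (A : Type u) [CommRing A] [Algebra K A], ∀ g ∈ G.points A,
    MvPolynomial.aeval (entries g.1) χ = 1

/-- `G` and `H` are isomorphic as algebraic groups over `K`: their functors of points are. -/
def IsIsomorphic (G : LinAlgGroup K n) (H : LinAlgGroup K m) : Prop :=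
  ∃ e : ∀ (A : Type u) [CommRing A] [Algebra K A], G.points A ≃* H.points A,
    ∀ (A B : Type u) [CommRing A] [Algebra K A] [CommRing B] [Algebra K B] (φ : A →ₐ[K] B)
      (g : G.points A), e B (G.pointsMap φ g) = H.pointsMap φ (e A g)

/-- `G` is the (internal) semidirect product `T ⋉ U` of its algebraic `K`-subgroups `T` and `U`,
with `U` normal. -/
def IsSemidirect (G T U : LinAlgGroup K n) : Prop :=
  ∀ (A : Type u) [CommRing A] [Algebra K A],
    T.points A ≤ G.points A ∧ U.points A ≤ G.points A ∧
    (∀ g ∈ G.points A, ∀ x ∈ U.points A, g * x * g⁻¹ ∈ U.points A) ∧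
    T.points A ⊓ U.points A = ⊥ ∧
    ∀ g ∈ G.points A, ∃ t ∈ T.points A, ∃ x ∈ U.points A, g = t * x

/-- The centralizer `C_T(U)` of `U` in `T` is trivial. -/
def TrivialCentralizer (T U : LinAlgGroup K n) : Prop :=
  ∀ t ∈ T.points (AlgebraicClosure K),
    (∀ x ∈ U.points (AlgebraicClosure K), t * x = x * t) → t = 1

/-- The Lie algebra of `G` over `A`: the matrices `X` over `A` such that `1 + ε X ∈ G(A[ε])`,
where `ε ^ 2 = 0`. -/
def lieAlg (G : LinAlgGroup K n) (A : Type u) [CommRing A] [Algebra K A] :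
    Submodule A (Matrix (Fin n) (Fin n) A) where
  carrier := {X | ∃ g ∈ G.points (DualNumber A), ∀ i j,
    g.1 i j = TrivSqZeroExt.inl ((1 : Matrix (Fin n) (Fin n) A) i j) + TrivSqZeroExt.inr (X i j)}
  zero_mem' := ⟨1, one_mem _, fun i j => by
    by_cases h : i = j <;> simp [Matrix.one_apply, h]⟩
  add_mem' := by
    rintro X Y ⟨g, hg, hgX⟩ ⟨h, hh, hhY⟩
    refine ⟨g * h, mul_mem hg hh, fun i j => ?_⟩
    have e1 : g.1 = (1 : Matrix (Fin n) (Fin n) A).map TrivSqZeroExt.inl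
        + X.map TrivSqZeroExt.inr := by ext1 i j; exact hgX i j
    have e2 : h.1 = (1 : Matrix (Fin n) (Fin n) A).map TrivSqZeroExt.inl
        + Y.map TrivSqZeroExt.inr := by ext1 i j; exact hhY i j
    have e3 : X.map TrivSqZeroExt.inr * Y.map TrivSqZeroExt.inr
        = (0 : Matrix (Fin n) (Fin n) (DualNumber A)) := by
      ext1 i j
      simp [Matrix.mul_apply]
    have e4 : (1 : Matrix (Fin n) (Fin n) A).map TrivSqZeroExt.inl
        = (1 : Matrix (Fin n) (Fin n) (DualNumber A)) := by
      ext1 i j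
      by_cases h : i = j <;> simp [Matrix.one_apply, h]
    have : (g * h).1 = 1 + (X.map TrivSqZeroExt.inr + Y.map TrivSqZeroExt.inr) := by
      change g.1 * h.1 = _
      rw [e1, e2, e4, add_mul, mul_add, mul_add, e3, one_mul, one_mul, mul_one, add_zero]
      abel
    rw [this, ← e4]
    simp [-DualNumber.inr_eq_smul_eps]
  smul_mem' := by
    rintro a X ⟨g, hg, hgX⟩
    let φ : DualNumber A →ₐ[K] DualNumber A :=
      (TrivSqZeroExt.map (a • LinearMap.id : A →ₗ[A] A)).restrictScalars K
    refine ⟨_, G.map_mem_points φ hg, fun i j => ?_⟩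
    change φ (g.1 i j) = _
    rw [hgX, map_add]
    simp [φ, -DualNumber.inr_eq_smul_eps]

theorem conj_mem_lieAlg (G : LinAlgGroup K n) {A : Type u} [CommRing A] [Algebra K A]
    {g : Matrix.SpecialLinearGroup (Fin n) A} (hg : g ∈ G.points A)
    {X : Matrix (Fin n) (Fin n) A} (hX : X ∈ G.lieAlg A) :
    g.1 * X * (g⁻¹).1 ∈ G.lieAlg A := by
  obtain ⟨x, hx, hxX⟩ := hX
  let ι : A →ₐ[K] DualNumber A := TrivSqZeroExt.inlAlgHom K A A
  have h1 := G.map_mem_points ι hg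
  have h2 := G.map_mem_points ι (inv_mem hg)
  refine ⟨_, mul_mem (mul_mem h1 hx) h2, fun i j => ?_⟩
  have e1 : x.1 = 1 + X.map TrivSqZeroExt.inr := by
    ext1 i j
    rw [hxX]
    by_cases h : i = j <;> simp [Matrix.one_apply, h]
  have e2 : g.1.map ι * (g⁻¹).1.map ι = 1 := by
    have : g.1 * (g⁻¹).1 = 1 := congrArg Subtype.val (mul_inv_cancel g)
    rw [← Matrix.map_mul, this]
    simp
  have e3 : g.1.map ι * X.map TrivSqZeroExt.inr * (g⁻¹).1.map ι
      = (g.1 * X * (g⁻¹).1).map TrivSqZeroExt.inr := by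
    have e4 : ∀ Y : Matrix (Fin n) (Fin n) A,
        g.1.map ι * Y.map TrivSqZeroExt.inr = (g.1 * Y).map TrivSqZeroExt.inr := fun Y => by
      ext1 i j
      change _ = TrivSqZeroExt.inrHom A A ((g.1 * Y) i j)
      rw [Matrix.mul_apply, Matrix.mul_apply, map_sum]
      exact Finset.sum_congr rfl fun k _ => TrivSqZeroExt.inl_mul_inr _ _
    have e5 : ∀ Y : Matrix (Fin n) (Fin n) A, Y.map TrivSqZeroExt.inr * (g⁻¹).1.map ι =
        (Y * (g⁻¹).1).map TrivSqZeroExt.inr := fun Y => by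
      ext1 i j
      change _ = TrivSqZeroExt.inrHom A A ((Y * (g⁻¹).1) i j)
      rw [Matrix.mul_apply, Matrix.mul_apply, map_sum]
      exact Finset.sum_congr rfl fun k _ => TrivSqZeroExt.inr_mul_inl _ _
    rw [e4, e5]
  change (g.1.map ι * x.1 * (g⁻¹).1.map ι) i j = _
  rw [e1, mul_add, add_mul, mul_one, e2, e3]
  by_cases h : i = j <;> simp [Matrix.one_apply, h]

end Field

end LinAlgGroup

/-! ### The real structure of the archimedean completions -/

noncomputable section

namespace NumberField.InfinitePlace

variable {K : Type u} [Field K]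

open Classical in
/-- The embedding `ℝ → K_v`, for `v` an infinite place. -/
def realHom (v : InfinitePlace K) : ℝ →+* v.Completion :=
  if h : v.IsReal then (Completion.ringEquivRealOfIsReal h).symm.toRingHom
  else (Completion.ringEquivComplexOfIsComplex (not_isReal_iff_isComplex.1 h)).symm.toRingHom.comp
    Complex.ofRealHom

theorem extensionEmbedding_realHom (v : InfinitePlace K) (r : ℝ) :
    Completion.extensionEmbedding v (v.realHom r) = r := by
  unfold realHom
  split_ifs with h
  · rw [← Completion.extensionEmbeddingOfIsReal_apply h,
      ← Completion.ringEquivRealOfIsReal_apply]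
    simp
  · rw [← Completion.ringEquivComplexOfIsComplex_apply (not_isReal_iff_isComplex.1 h)]
    simp

instance instAlgebraRealCompletion (v : InfinitePlace K) : Algebra ℝ v.Completion :=
  v.realHom.toAlgebra

instance instFiniteRealCompletion (v : InfinitePlace K) : Module.Finite ℝ v.Completion :=
  let e : v.Completion →ₗ[ℝ] ℂ :=
    { toFun := Completion.extensionEmbedding v
      map_add' := map_add _
      map_smul' := fun r x => by
        rw [Algebra.smul_def, map_mul]
        change Completion.extensionEmbedding v (v.realHom r) * _ = _
        rw [extensionEmbedding_realHom]
        simp }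
  FiniteDimensional.of_injective e (Completion.extensionEmbedding v).injective

/-- The real coordinates (real and imaginary part) on `K_v ⊆ ℂ`. -/
def realCoord (v : InfinitePlace K) (x : v.Completion) (b : Bool) : ℝ :=
  if b then (Completion.extensionEmbedding v x).re else (Completion.extensionEmbedding v x).im

end NumberField.InfinitePlace

/-! ### Almost-Zariski closure in `GL_d(ℝ)` -/

/-- `A ≤ GL_d(ℝ)` is almost Zariski closed: `B° ⊆ A ⊆ B` for some Zariski closed subgroup `B`,
where `B°` is the identity component of `B` in the Lie group topology. -/
def IsAlmostZariskiClosed {d : ℕ} (A : Subgroup (GL (Fin d) ℝ)) : Prop :=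
  ∃ B : Subgroup (GL (Fin d) ℝ),
    Zariski.IsClosed (fun g : GL (Fin d) ℝ => entries g.1) (B : Set (GL (Fin d) ℝ)) ∧
    connectedComponentIn (B : Set (GL (Fin d) ℝ)) 1 ⊆ A ∧ A ≤ B

/-- The almost-Zariski closure: the smallest almost-Zariski closed subgroup containing `A`. -/
def almostZariskiClosure {d : ℕ} (A : Subgroup (GL (Fin d) ℝ)) : Subgroup (GL (Fin d) ℝ) :=
  sInf {B | IsAlmostZariskiClosed B ∧ A ≤ B}

/-! ### `S`-arithmetic groups

A finite set of places of `K` containing all the infinite places is given by the finite set `S` of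
its finite places. -/

namespace LinAlgGroup

variable {K : Type u} [Field K] {n : ℕ}

/-- `G_∞ = ∏ G(K_v)`, over the infinite places `v`. -/
abbrev Infty (G : LinAlgGroup K n) : Type u := ∀ v : InfinitePlace K, G.points v.Completion

/-- The diagonal embedding of `G(K)` in `G_∞`. -/
def diagInfty (G : LinAlgGroup K n) : G.points K →* G.Infty :=
  MonoidHom.pi fun v => G.pointsMap (Algebra.ofId K v.Completion)

/-- The real coordinates on `∏ SL_n(K_v)`, over the infinite places `v`: they define the
Zariski topology obtained by restriction of scalars from `K_v` to `ℝ`. -/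
def realEntries
    (g : ∀ v : InfinitePlace K, Matrix.SpecialLinearGroup (Fin n) v.Completion) :
    InfinitePlace K × (Fin n × Fin n) × Bool → ℝ :=
  fun a => a.1.realCoord (entries (g a.1).1 a.2.1) a.2.2

/-- The Lie algebra of the real Lie group `G_∞`. -/
def lieInfty (G : LinAlgGroup K n) :
    Submodule ℝ (∀ v : InfinitePlace K, Matrix (Fin n) (Fin n) v.Completion) where
  carrier := {X | ∀ v, X v ∈ G.lieAlg v.Completion}
  zero_mem' v := zero_mem _
  add_mem' hX hY v := add_mem (hX v) (hY v)
  smul_mem' r X hX v := by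
    have : (r • X) v = algebraMap ℝ v.Completion r • X v := by
      ext1 i j
      exact Algebra.smul_def r (X v i j)
    rw [this]
    exact Submodule.smul_mem _ _ (hX v)

/-- The adjoint representation of `G_∞` on its Lie algebra. -/
def Ad (G : LinAlgGroup K n) : G.Infty →* Module.End ℝ G.lieInfty where
  toFun g :=
    { toFun := fun X => ⟨fun v => (g v).1.1 * X.1 v * ((g v).1⁻¹).1,
        fun v => G.conj_mem_lieAlg (g v).2 (X.2 v)⟩
      map_add' := fun X Y => by
        ext1
        funext v
        change _ * (X.1 v + Y.1 v) * _ = _ * X.1 v * _ + _ * Y.1 v * _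
        rw [mul_add, add_mul]
      map_smul' := fun r X => by
        ext1
        funext v
        change _ * (r • X.1 v) * _ = r • (_ * X.1 v * _)
        rw [mul_smul_comm, smul_mul_assoc] }
  map_one' := by
    ext1 X
    ext1
    funext v
    change (1 : Matrix (Fin n) (Fin n) v.Completion) * X.1 v *
      ((1 : Matrix.SpecialLinearGroup (Fin n) v.Completion)⁻¹).1 = X.1 v
    rw [inv_one, one_mul]
    exact mul_one _
  map_mul' g h := by
    ext1 X
    ext1
    funext v
    change ((g v).1 * (h v).1).1 * X.1 v * (((g v).1 * (h v).1)⁻¹).1 =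
      (g v).1.1 * ((h v).1.1 * X.1 v * ((h v).1⁻¹).1) * ((g v).1⁻¹).1
    rw [mul_inv_rev]
    change (g v).1.1 * (h v).1.1 * X.1 v * (((h v).1⁻¹).1 * ((g v).1⁻¹).1) = _
    simp only [mul_assoc]

variable [NumberField K]

/-- The `S`-integral points `G_{O(S)}` of `G`. -/
def sIntegralPoints (G : LinAlgGroup K n) (S : Finset (HeightOneSpectrum (𝓞 K))) :
    Subgroup (G.points K) :=
  ((Matrix.SpecialLinearGroup.map
    (algebraMap ((S : Set (HeightOneSpectrum (𝓞 K))).integer K) K)).range).subgroupOf (G.points K)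

/-- `G_{O(S)}` is Zariski dense in `G`. -/
def IsZariskiDense (G : LinAlgGroup K n) (S : Finset (HeightOneSpectrum (𝓞 K))) : Prop :=
  Zariski.DenseIn
    (fun g : Matrix.SpecialLinearGroup (Fin n) (AlgebraicClosure K) => entries g.1)
    ((fun g => (G.pointsMap (Algebra.ofId K (AlgebraicClosure K)) g).1) ''
      (G.sIntegralPoints S : Set (G.points K)))
    (G.points (AlgebraicClosure K))

/-- `G_{O(S)}` is Zariski dense in `G_∞`, for the real Zariski topology on `G_∞`. -/
def IsZariskiDenseInfty (G : LinAlgGroup K n) (S : Finset (HeightOneSpectrum (𝓞 K))) : Prop :=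
  Zariski.DenseIn realEntries
    ((fun g v => (G.diagInfty g v).1) '' (G.sIntegralPoints S : Set (G.points K)))
    {g | ∀ v, g v ∈ G.points v.Completion}

/-- `G_S = G_∞ × G_f`, where `G_f = ∏ G(K_v)`, over the finite places `v ∈ S`. -/
abbrev SPoints (G : LinAlgGroup K n) (S : Finset (HeightOneSpectrum (𝓞 K))) : Type u :=
  G.Infty × (∀ v : S, G.points (v.1.adicCompletion K))

/-- `∏ ‖χ(x_v)‖_v` over all `v ∈ S`, infinite or finite, with the normalized absolute values. -/
def charNorm (G : LinAlgGroup K n) (S : Finset (HeightOneSpectrum (𝓞 K)))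
    (χ : MvPolynomial (Fin n × Fin n) K) (x : G.SPoints S) : ℝ :=
  (∏ v : InfinitePlace K, ‖MvPolynomial.aeval (entries (x.1 v).1.1) χ‖ ^ v.mult) *
    ∏ v : S, ‖MvPolynomial.aeval (entries (x.2 v).1.1) χ‖

theorem charNorm_one (G : LinAlgGroup K n) (S : Finset (HeightOneSpectrum (𝓞 K)))
    {χ : MvPolynomial (Fin n × Fin n) K} (hχ : G.IsCharacter χ) : G.charNorm S χ 1 = 1 := by
  have h1 : ∀ v : InfinitePlace K,
      ‖MvPolynomial.aeval (entries ((1 : G.SPoints S).1 v).1.1) χ‖ ^ v.mult = 1 := fun v => by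
    have := (hχ v.Completion).1
    change ‖MvPolynomial.aeval (entries (1 : Matrix (Fin n) (Fin n) v.Completion)) χ‖ ^ _ = 1
    rw [this]; simp
  have h2 : ∀ v : S,
      ‖MvPolynomial.aeval (entries ((1 : G.SPoints S).2 v).1.1) χ‖ = 1 := fun v => by
    have := (hχ (v.1.adicCompletion K)).1
    change ‖MvPolynomial.aeval (entries (1 : Matrix (Fin n) (Fin n) (v.1.adicCompletion K))) χ‖ = 1
    rw [this]; simp
  rw [charNorm, Finset.prod_congr rfl fun v _ => h1 v, Finset.prod_congr rfl fun v _ => h2 v]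
  simp

theorem charNorm_mul (G : LinAlgGroup K n) (S : Finset (HeightOneSpectrum (𝓞 K)))
    {χ : MvPolynomial (Fin n × Fin n) K} (hχ : G.IsCharacter χ) (x y : G.SPoints S) :
    G.charNorm S χ (x * y) = G.charNorm S χ x * G.charNorm S χ y := by
  have h1 : ∀ v : InfinitePlace K,
      ‖MvPolynomial.aeval (entries ((x * y).1 v).1.1) χ‖ ^ v.mult =
      ‖MvPolynomial.aeval (entries (x.1 v).1.1) χ‖ ^ v.mult *
      ‖MvPolynomial.aeval (entries (y.1 v).1.1) χ‖ ^ v.mult := fun v => by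
    rw [← mul_pow, ← norm_mul, ← (hχ v.Completion).2 _ (x.1 v).2 _ (y.1 v).2]
    rfl
  have h2 : ∀ v : S,
      ‖MvPolynomial.aeval (entries ((x * y).2 v).1.1) χ‖ =
      ‖MvPolynomial.aeval (entries (x.2 v).1.1) χ‖ *
      ‖MvPolynomial.aeval (entries (y.2 v).1.1) χ‖ := fun v => by
    rw [← norm_mul, ← (hχ (v.1.adicCompletion K)).2 _ (x.2 v).2 _ (y.2 v).2]
    rfl
  rw [charNorm, Finset.prod_congr rfl fun v _ => h1 v, Finset.prod_congr rfl fun v _ => h2 v,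
    Finset.prod_mul_distrib, Finset.prod_mul_distrib, charNorm, charNorm]
  ring

/-- The group `G_S^*` of all `x ∈ G_S` with `∏ ‖χ(x_v)‖_v = 1` for all `K`-characters `χ` of `G`. -/
def Gs (G : LinAlgGroup K n) (S : Finset (HeightOneSpectrum (𝓞 K))) :
    Subgroup (G.SPoints S) where
  carrier := {x | ∀ χ, G.IsCharacter χ → G.charNorm S χ x = 1}
  one_mem' χ hχ := G.charNorm_one S hχ
  mul_mem' {x y} hx hy χ hχ := by rw [G.charNorm_mul S hχ, hx χ hχ, hy χ hχ, one_mul]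
  inv_mem' {x} hx χ hχ := by
    have h := G.charNorm_mul S hχ x⁻¹ x
    rw [inv_mul_cancel, G.charNorm_one S hχ, hx χ hχ, mul_one] at h
    exact h.symm

/-- The adjoint representation of `G_∞`, in matrix form with respect to a basis of the Lie algebra
of `G_∞` over `ℝ`. -/
def AdMatrix (G : LinAlgGroup K n) :
    G.Infty →* GL (Fin (Module.finrank ℝ G.lieInfty)) ℝ :=
  MonoidHom.toHomUnits
    (((LinearMap.toMatrixAlgEquiv (Module.finBasis ℝ G.lieInfty)).toAlgHom :
      Module.End ℝ G.lieInfty →* _).comp G.Ad)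

/-- The group `G_S°` of all `x ∈ G_S^*` such that `Ad x` belongs to the almost-Zariski closure of
`Ad G_{O(S)}`, where `Ad` is the adjoint representation of `G_∞`. -/
def GoS (G : LinAlgGroup K n) (S : Finset (HeightOneSpectrum (𝓞 K))) :
    Subgroup (G.SPoints S) :=
  G.Gs S ⊓ (almostZariskiClosure
    ((G.sIntegralPoints S).map (G.AdMatrix.comp G.diagInfty))).comap
      (G.AdMatrix.comp (MonoidHom.fst _ _))

end LinAlgGroup

end

/-! ### The special orthogonal group of `x² + q y²` -/

/-- The matrix of the quadratic form `x² + q y²`. -/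
def formMatrix (A : Type*) [CommRing A] (q : ℕ) : Matrix (Fin 2) (Fin 2) A :=
  !![1, 0; 0, (q : A)]

/-- The entries of `Xᵀ Q X - Q`, where `X` is the generic matrix and `Q = diag(1, q)`. -/
noncomputable def formEqn (K : Type u) [Field K] (q : ℕ) :
    Matrix (Fin 2) (Fin 2) (MvPolynomial (Fin 2 × Fin 2) K) :=
  (Matrix.mvPolynomialX (Fin 2) (Fin 2) K).transpose * formMatrix _ q *
    Matrix.mvPolynomialX (Fin 2) (Fin 2) K - formMatrix _ q

theorem aeval_formEqn {K : Type u} [Field K] {A : Type u} [CommRing A] [Algebra K A] (q : ℕ)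
    (g : Matrix (Fin 2) (Fin 2) A) :
    (formEqn K q).map (MvPolynomial.aeval (entries g)) =
    g.transpose * formMatrix A q * g - formMatrix A q := by
  ext i j
  fin_cases i <;> fin_cases j <;>
    simp [formEqn, formMatrix, entries, Matrix.mul_apply, Fin.sum_univ_two, Matrix.mvPolynomialX]

theorem forall_formEqn_iff {K : Type u} [Field K] {A : Type u} [CommRing A] [Algebra K A] (q : ℕ)
    (g : Matrix (Fin 2) (Fin 2) A) :
    (∀ f ∈ Set.range fun ij : Fin 2 × Fin 2 => formEqn K q ij.1 ij.2,
      MvPolynomial.aeval (entries g) f = 0) ↔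
    g.transpose * formMatrix A q * g = formMatrix A q := by
  rw [← sub_eq_zero, ← aeval_formEqn (K := K), Set.forall_mem_range]
  exact ⟨fun h => by ext i j; exact h (i, j), fun h ij => congrFun (congrFun h ij.1) ij.2⟩

/-- `SO(x² + q y²)`: the `g ∈ SL_2` preserving the form, `gᵀ Q g = Q` with `Q = diag(1, q)`. -/
noncomputable def soForm (K : Type u) [Field K] (q : ℕ) : LinAlgGroup K 2 where
  eqns := Set.range fun ij : Fin 2 × Fin 2 => formEqn K q ij.1 ij.2
  one_mem' A _ _ := by rw [forall_formEqn_iff]; simp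
  mul_mem' A _ _ g h := by
    simp only [forall_formEqn_iff]
    intro hg hh
    change (g.1 * h.1).transpose * _ * (g.1 * h.1) = _
    rw [Matrix.transpose_mul, show h.1.transpose * g.1.transpose * formMatrix A q * (g.1 * h.1) =
      h.1.transpose * (g.1.transpose * formMatrix A q * g.1) * h.1 by simp only [mul_assoc], hg, hh]
  inv_mem' A _ _ g := by
    simp only [forall_formEqn_iff]
    intro hg
    have e : g.1 * (g⁻¹).1 = 1 := congrArg Subtype.val (mul_inv_cancel g)
    have e' : ((g⁻¹).1).transpose * g.1.transpose = 1 := by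
      rw [← Matrix.transpose_mul, e, Matrix.transpose_one]
    calc ((g⁻¹).1).transpose * formMatrix A q * (g⁻¹).1
        = ((g⁻¹).1).transpose * (g.1.transpose * formMatrix A q * g.1) * (g⁻¹).1 := by rw [hg]
      _ = (((g⁻¹).1).transpose * g.1.transpose) * formMatrix A q * (g.1 * (g⁻¹).1) := by
        simp only [mul_assoc]
      _ = formMatrix A q := by rw [e, e', one_mul, mul_one]

/-! The field `K` is stable under complex conjugation, which commutes with every embedding in `ℂ`.
For a rotation `t = (a, b)` with `a² + q b² = 1` and integral `a`, `b`, the product `t t̄` is the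
rotation with coordinates `α = a ā - q b b̄` and `β = a b̄ + b ā`. These are algebraic integers of
`K`, and every embedding makes `(α, β)` a real point of the ellipse `α² + q β² = 1`, so all
conjugates have absolute value at most `1`. Only finitely many such integers exist. Hence `t ↦ t
t̄`, which is polynomial in real and imaginary parts, takes finitely many values on the integral
rotations, whereas on real rotations `α = a² - q b²` runs through all of `[-1, 1]`. This refutes
real Zariski density (`exists_boundedIntegers`, `exists_real_norm_one_notMem`).

For the second part, `G` is the group of motions of the plane, the rotations acting on translations
in the standard way. It has a dense set of integral points: Pell's equation `X² - q Y² = 1` supplies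
infinitely many rotations `(X, iY)`, and the translations by integers do the rest.

To see the obstruction in the adjoint representation, let `σ (x, y) = (x̄, -ȳ)` on the Lie algebra
of translations. Since `σ t⁻¹ σ = t̄`, a motion with rotation part `t` carries the fixed space of
`σ` to the fixed space of `t t̄ σ` (`map_Ad_realForm`). The integral points therefore permute a
finite set of real subspaces. Permuting a finite set of subspaces is a Zariski closed condition, so
it passes to the almost-Zariski closure (`map_mem_of_mem_almostZariskiClosure`); a suitable real
rotation violates it. That rotation lies in `G_S^*` because `-q` is not a square in `K`, so that
every character is trivial on rotations: the nontrivial automorphism of `K(√-q)` inverts the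
eigenvalue of a rotation (`aeval_eq_one_of_multiplicative`). -/

/-! ### The plane motion group of the form `x² + q y²` -/

namespace SOForm

/-- The matrix of the rotation `(a, b)`. -/
def rotationMatrix {A : Type*} [CommRing A] (q : ℕ) (a b : A) : Matrix (Fin 2) (Fin 2) A :=
  !![a, -(q * b); b, a]

/-- The matrix of the motion with rotation part `(a, b)` and translation part `(x, y)`. -/
def motionMatrix {A : Type*} [CommRing A] (q : ℕ) (a b x y : A) : Matrix (Fin 3) (Fin 3) A :=
  !![a, -(q * b), x; b, a, y; 0, 0, 1]

section Motion

variable {A : Type*} [CommRing A] {q : ℕ}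

theorem rotationMatrix_mul (a b a' b' : A) :
    rotationMatrix q a b * rotationMatrix q a' b' =
      rotationMatrix q (a * a' - q * (b * b')) (a * b' + b * a') := by
  ext i j
  fin_cases i <;> fin_cases j <;> simp [rotationMatrix, Matrix.mul_apply, Fin.sum_univ_two] <;> ring

theorem rotationMatrix_one : rotationMatrix q (1 : A) 0 = 1 := by
  ext i j
  fin_cases i <;> fin_cases j <;> simp [rotationMatrix]

theorem det_rotationMatrix (a b : A) : (rotationMatrix q a b).det = a ^ 2 + q * b ^ 2 := by
  simp [rotationMatrix, Matrix.det_fin_two]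
  ring

theorem motionMatrix_mul (a b x y a' b' x' y' : A) :
    motionMatrix q a b x y * motionMatrix q a' b' x' y' =
      motionMatrix q (a * a' - q * (b * b')) (a * b' + b * a')
        (a * x' - q * b * y' + x) (b * x' + a * y' + y) := by
  ext i j
  fin_cases i <;> fin_cases j <;> simp [motionMatrix, Matrix.mul_apply, Fin.sum_univ_three] <;> ring

theorem motionMatrix_one : motionMatrix q (1 : A) 0 0 0 = 1 := by
  ext i j
  fin_cases i <;> fin_cases j <;> simp [motionMatrix]

theorem det_motionMatrix (a b x y : A) : (motionMatrix q a b x y).det = a ^ 2 + q * b ^ 2 := by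
  simp [motionMatrix, Matrix.det_fin_three]
  ring

theorem motionMatrix_inj {a b x y a' b' x' y' : A} :
    motionMatrix q a b x y = motionMatrix q a' b' x' y' ↔ a = a' ∧ b = b' ∧ x = x' ∧ y = y' := by
  refine ⟨fun h => ⟨?_, ?_, ?_, ?_⟩, ?_⟩
  · simpa [motionMatrix] using congrFun (congrFun h 0) 0
  · simpa [motionMatrix] using congrFun (congrFun h 1) 0
  · simpa [motionMatrix] using congrFun (congrFun h 0) 2
  · simpa [motionMatrix] using congrFun (congrFun h 1) 2
  · rintro ⟨rfl, rfl, rfl, rfl⟩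
    rfl

/-- The rotation `(a, b)`, as an element of `SL_2`. -/
def rotation (a b : A) (h : a ^ 2 + q * b ^ 2 = 1) : Matrix.SpecialLinearGroup (Fin 2) A :=
  ⟨rotationMatrix q a b, (det_rotationMatrix a b).trans h⟩

/-- The motion with rotation part `(a, b)` and translation part `(x, y)`, as an element of
`SL_3`. -/
def motion (a b x y : A) (h : a ^ 2 + q * b ^ 2 = 1) : Matrix.SpecialLinearGroup (Fin 3) A :=
  ⟨motionMatrix q a b x y, (det_motionMatrix a b x y).trans h⟩

theorem norm_inv {a b : A} (h : a ^ 2 + q * b ^ 2 = 1) : a ^ 2 + q * (-b) ^ 2 = 1 := by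
  rwa [neg_sq]

theorem motion_inv (a b x y : A) (h : a ^ 2 + q * b ^ 2 = 1) :
    (motion a b x y h)⁻¹ = motion a (-b) (-(a * x + q * b * y)) (b * x - a * y)
      (norm_inv h) := by
  rw [inv_eq_iff_mul_eq_one]
  refine Subtype.ext ?_
  change motionMatrix q a b x y * motionMatrix q a (-b) _ _ = 1
  rw [motionMatrix_mul, ← motionMatrix_one (A := A) (q := q), motionMatrix_inj]
  refine ⟨?_, ?_, ?_, ?_⟩
  · linear_combination h
  · ring
  · linear_combination -x * h
  · linear_combination -y * h

variable (A q)

/-- The group of motions. -/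
def motions : Subgroup (Matrix.SpecialLinearGroup (Fin 3) A) where
  carrier := {g | ∃ a b x y : A, g.1 = motionMatrix q a b x y}
  one_mem' := ⟨1, 0, 0, 0, motionMatrix_one.symm⟩
  mul_mem' := by
    rintro g h ⟨a, b, x, y, hg⟩ ⟨a', b', x', y', hh⟩
    have := motionMatrix_mul (q := q) a b x y a' b' x' y'
    rw [← hg, ← hh] at this
    exact ⟨_, _, _, _, this⟩
  inv_mem' := by
    rintro g ⟨a, b, x, y, hg⟩
    have h : a ^ 2 + q * b ^ 2 = 1 := by rw [← det_motionMatrix a b x y, ← hg, g.2]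
    obtain rfl : g = motion a b x y h := Subtype.ext hg
    exact ⟨_, _, _, _, congrArg Subtype.val (motion_inv a b x y h)⟩

/-- The group of rotations, inside the group of motions. -/
def rotations : Subgroup (Matrix.SpecialLinearGroup (Fin 3) A) where
  carrier := {g | ∃ a b : A, g.1 = motionMatrix q a b 0 0}
  one_mem' := ⟨1, 0, motionMatrix_one.symm⟩
  mul_mem' := by
    rintro g h ⟨a, b, hg⟩ ⟨a', b', hh⟩
    have := motionMatrix_mul (q := q) a b 0 0 a' b' 0 0
    rw [← hg, ← hh] at this
    simp only [mul_zero, sub_zero, add_zero] at this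
    exact ⟨_, _, this⟩
  inv_mem' := by
    rintro g ⟨a, b, hg⟩
    have h : a ^ 2 + q * b ^ 2 = 1 := by rw [← det_motionMatrix a b 0 0, ← hg, g.2]
    obtain rfl : g = motion a b 0 0 h := Subtype.ext hg
    refine ⟨a, -b, (congrArg Subtype.val (motion_inv a b 0 0 h)).trans ?_⟩
    simp only [motion, mul_zero, sub_zero, add_zero, neg_zero]

/-- The group of translations. -/
def translations : Subgroup (Matrix.SpecialLinearGroup (Fin 3) A) where
  carrier := {g | ∃ x y : A, g.1 = motionMatrix q 1 0 x y}
  one_mem' := ⟨0, 0, motionMatrix_one.symm⟩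
  mul_mem' := by
    rintro g h ⟨x, y, hg⟩ ⟨x', y', hh⟩
    refine ⟨x' + x, y' + y, ?_⟩
    rw [Matrix.SpecialLinearGroup.coe_mul, hg, hh, motionMatrix_mul, motionMatrix_inj]
    simp
  inv_mem' := by
    rintro g ⟨x, y, hg⟩
    have h : (1 : A) ^ 2 + q * 0 ^ 2 = 1 := by simp
    obtain rfl : g = motion 1 0 x y h := Subtype.ext hg
    refine ⟨-x, -y, (congrArg Subtype.val (motion_inv 1 0 x y h)).trans ?_⟩
    rw [motion, motionMatrix_inj]
    simp

variable {A q}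

/-- The norm equation is the condition `det = 1` in `SL_3`, so the linear equations on the entries
already cut out the group. -/
theorem mem_motions_iff {g : Matrix.SpecialLinearGroup (Fin 3) A} :
    g ∈ motions A q ↔ ∃ (a b x y : A) (h : a ^ 2 + q * b ^ 2 = 1), g = motion a b x y h := by
  refine ⟨?_, fun ⟨a, b, x, y, h, hg⟩ => ⟨a, b, x, y, congrArg Subtype.val hg⟩⟩
  rintro ⟨a, b, x, y, hg⟩
  refine ⟨a, b, x, y, ?_, Subtype.ext hg⟩
  rw [← det_motionMatrix a b x y, ← hg, g.2]

theorem mem_rotations_iff {g : Matrix.SpecialLinearGroup (Fin 3) A} :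
    g ∈ rotations A q ↔ ∃ (a b : A) (h : a ^ 2 + q * b ^ 2 = 1), g = motion a b 0 0 h := by
  refine ⟨?_, fun ⟨a, b, h, hg⟩ => ⟨a, b, congrArg Subtype.val hg⟩⟩
  rintro ⟨a, b, hg⟩
  refine ⟨a, b, ?_, Subtype.ext hg⟩
  rw [← det_motionMatrix a b 0 0, ← hg, g.2]

end Motion

end SOForm

/-! ### Constructing linear algebraic groups from their points -/

/-- The linear algebraic group with given groups of points, given by equations. -/
def LinAlgGroup.ofSubgroup {K : Type u} [Field K] {n : ℕ}
    (E : Set (MvPolynomial (Fin n × Fin n) K))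
    (H : ∀ (A : Type u) [CommRing A] [Algebra K A], Subgroup (Matrix.SpecialLinearGroup (Fin n) A))
    (hH : ∀ (A : Type u) [CommRing A] [Algebra K A] (g : Matrix.SpecialLinearGroup (Fin n) A),
      (∀ f ∈ E, MvPolynomial.aeval (entries g.1) f = 0) ↔ g ∈ H A) : LinAlgGroup K n where
  eqns := E
  one_mem' A _ _ := (hH A 1).2 (one_mem _)
  mul_mem' A _ _ g h hg hh := (hH A (g * h)).2 (mul_mem ((hH A g).1 hg) ((hH A h).1 hh))
  inv_mem' A _ _ g hg := (hH A g⁻¹).2 (inv_mem ((hH A g).1 hg))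

theorem LinAlgGroup.ofSubgroup_points {K : Type u} [Field K] {n : ℕ}
    (E : Set (MvPolynomial (Fin n × Fin n) K))
    (H : ∀ (A : Type u) [CommRing A] [Algebra K A], Subgroup (Matrix.SpecialLinearGroup (Fin n) A))
    (hH : ∀ (A : Type u) [CommRing A] [Algebra K A] (g : Matrix.SpecialLinearGroup (Fin n) A),
      (∀ f ∈ E, MvPolynomial.aeval (entries g.1) f = 0) ↔ g ∈ H A)
    (A : Type u) [CommRing A] [Algebra K A] :
    (LinAlgGroup.ofSubgroup E H hH).points A = H A :=
  Subgroup.ext (hH A)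

namespace SOForm

open MvPolynomial in
/-- The equations of the group of motions. -/
noncomputable def motionEqns (K : Type u) [Field K] (q : ℕ) : Set (MvPolynomial (Fin 3 × Fin 3) K) :=
  {X (2, 0), X (2, 1), X (2, 2) - 1, X (1, 1) - X (0, 0), X (0, 1) + (q : MvPolynomial _ K) * X (1, 0)}

variable (K : Type u) [Field K] (q : ℕ)

theorem motionEqns_iff {A : Type u} [CommRing A] [Algebra K A]
    (g : Matrix.SpecialLinearGroup (Fin 3) A) :
    (∀ f ∈ motionEqns K q, MvPolynomial.aeval (entries g.1) f = 0) ↔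
      g.1 = motionMatrix q (g.1 0 0) (g.1 1 0) (g.1 0 2) (g.1 1 2) := by
  simp only [motionEqns, Set.forall_mem_insert, Set.mem_singleton_iff, forall_eq, map_add, map_sub,
    map_mul, map_one, map_natCast, MvPolynomial.aeval_X, entries]
  constructor
  · rintro ⟨h1, h2, h3, h4, h5⟩
    ext i j
    fin_cases i <;> fin_cases j <;> simp [motionMatrix, h1, h2, sub_eq_zero.1 h3, sub_eq_zero.1 h4,
      eq_neg_of_add_eq_zero_left h5]
  · intro h
    rw [h]
    simp [motionMatrix]

/-- The group of motions, as a linear algebraic group. -/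
noncomputable def motionGroup : LinAlgGroup K 3 :=
  .ofSubgroup (motionEqns K q) (fun A => motions A q) fun A _ _ g => by
    rw [motionEqns_iff]
    refine ⟨fun h => ⟨_, _, _, _, h⟩, ?_⟩
    rintro ⟨a, b, x, y, h⟩
    rw [h]
    simp [motionMatrix]

open MvPolynomial in
/-- The group of rotations, as a linear algebraic group. -/
noncomputable def rotationGroup : LinAlgGroup K 3 :=
  .ofSubgroup (motionEqns K q ∪ {X (0, 2), X (1, 2)}) (fun A => rotations A q) fun A _ _ g => by
    simp only [Set.mem_union, or_imp, forall_and, motionEqns_iff, Set.forall_mem_insert,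
      Set.mem_singleton_iff, forall_eq, MvPolynomial.aeval_X, entries]
    refine ⟨fun h => ⟨g.1 0 0, g.1 1 0, ?_⟩, ?_⟩
    · rw [h.2.1, h.2.2] at h
      exact h.1
    · rintro ⟨a, b, h⟩
      rw [h]
      simp [motionMatrix]

open MvPolynomial in
/-- The group of translations, as a linear algebraic group. -/
noncomputable def translationGroup : LinAlgGroup K 3 :=
  .ofSubgroup (motionEqns K q ∪ {X (0, 0) - 1, X (1, 0)}) (fun A => translations A q)
    fun A _ _ g => by
    simp only [Set.mem_union, or_imp, forall_and, motionEqns_iff, Set.forall_mem_insert,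
      Set.mem_singleton_iff, forall_eq, MvPolynomial.aeval_X, entries, map_sub, map_one, sub_eq_zero]
    refine ⟨fun h => ⟨g.1 0 2, g.1 1 2, ?_⟩, ?_⟩
    · rw [h.2.1, h.2.2] at h
      exact h.1
    · rintro ⟨a, b, h⟩
      rw [h]
      simp [motionMatrix]

variable {K q} {A : Type u} [CommRing A] [Algebra K A]

theorem mem_motionGroup {g : Matrix.SpecialLinearGroup (Fin 3) A} :
    g ∈ (motionGroup K q).points A ↔
      ∃ (a b x y : A) (h : a ^ 2 + q * b ^ 2 = 1), g = motion a b x y h := by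
  rw [motionGroup, LinAlgGroup.ofSubgroup_points]
  exact mem_motions_iff

theorem mem_rotationGroup {g : Matrix.SpecialLinearGroup (Fin 3) A} :
    g ∈ (rotationGroup K q).points A ↔
      ∃ (a b : A) (h : a ^ 2 + q * b ^ 2 = 1), g = motion a b 0 0 h := by
  rw [rotationGroup, LinAlgGroup.ofSubgroup_points]
  exact mem_rotations_iff

theorem mem_translationGroup {g : Matrix.SpecialLinearGroup (Fin 3) A} :
    g ∈ (translationGroup K q).points A ↔
      ∃ x y : A, g = motion (q := q) 1 0 x y (by simp) := by
  rw [translationGroup, LinAlgGroup.ofSubgroup_points]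
  exact ⟨fun ⟨x, y, h⟩ => ⟨x, y, Subtype.ext h⟩, fun ⟨x, y, h⟩ => ⟨x, y, congrArg Subtype.val h⟩⟩

/-- Invariance of the form reads `gᵀ Q = Q g⁻¹`. For `2 × 2` matrices of determinant `1` the inverse
is linear in the entries, so the quadratic equations become linear ones, and no division by `q` is
needed. -/
theorem mem_soForm {g : Matrix.SpecialLinearGroup (Fin 2) A} :
    g ∈ (soForm K q).points A ↔
      ∃ (a b : A) (h : a ^ 2 + q * b ^ 2 = 1), g = rotation a b h := by
  refine (forall_formEqn_iff q g.1).trans ⟨fun h => ?_, ?_⟩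
  · have e : g.1 * (g⁻¹).1 = 1 := congrArg Subtype.val (mul_inv_cancel g)
    have h' : g.1.transpose * formMatrix A q = formMatrix A q * (g⁻¹).1 :=
      calc g.1.transpose * formMatrix A q
          = g.1.transpose * formMatrix A q * (g.1 * (g⁻¹).1) := by rw [e, mul_one]
        _ = g.1.transpose * formMatrix A q * g.1 * (g⁻¹).1 := by simp only [mul_assoc]
        _ = formMatrix A q * (g⁻¹).1 := by rw [h]
    rw [Matrix.SpecialLinearGroup.coe_inv, Matrix.adjugate_fin_two] at h'
    have h1 : g.1 1 1 = g.1 0 0 := by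
      simpa [formMatrix, Matrix.mul_apply, Fin.sum_univ_two] using
        (congrFun (congrFun h' 0) 0).symm
    have h2 : g.1 0 1 = -(q * g.1 1 0) := by
      have := congrFun (congrFun h' 0) 1
      simp [formMatrix, Matrix.mul_apply, Fin.sum_univ_two] at this
      linear_combination this
    have h3 : g.1 = rotationMatrix q (g.1 0 0) (g.1 1 0) := by
      ext i j
      fin_cases i <;> fin_cases j <;> simp [rotationMatrix, h1, h2]
    refine ⟨g.1 0 0, g.1 1 0, ?_, Subtype.ext h3⟩
    rw [← det_rotationMatrix, ← h3, g.2]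
  · rintro ⟨a, b, h, rfl⟩
    ext i j
    fin_cases i <;> fin_cases j <;>
      simp [rotation, rotationMatrix, formMatrix, Matrix.mul_apply, Fin.sum_univ_two] <;>
      first | linear_combination h | linear_combination (q : A) * h | ring

section Motion

variable {A : Type*} [CommRing A] {q : ℕ}

theorem motion_inj {a b x y a' b' x' y' : A} {h : a ^ 2 + q * b ^ 2 = 1}
    {h' : a' ^ 2 + q * b' ^ 2 = 1} :
    motion a b x y h = motion a' b' x' y' h' ↔ a = a' ∧ b = b' ∧ x = x' ∧ y = y' :=
  Subtype.ext_iff.trans motionMatrix_inj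

theorem norm_mul {a b a' b' : A} (h : a ^ 2 + q * b ^ 2 = 1) (h' : a' ^ 2 + q * b' ^ 2 = 1) :
    (a * a' - q * (b * b')) ^ 2 + q * (a * b' + b * a') ^ 2 = 1 := by
  linear_combination (a' ^ 2 + q * b' ^ 2) * h + h'

theorem motion_mul {a b x y a' b' x' y' : A} (h : a ^ 2 + q * b ^ 2 = 1)
    (h' : a' ^ 2 + q * b' ^ 2 = 1) :
    motion a b x y h * motion a' b' x' y' h' =
      motion (a * a' - q * (b * b')) (a * b' + b * a')
        (a * x' - q * b * y' + x) (b * x' + a * y' + y) (norm_mul h h') :=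
  Subtype.ext (motionMatrix_mul ..)

theorem rotation_mul {a b a' b' : A} (h : a ^ 2 + q * b ^ 2 = 1)
    (h' : a' ^ 2 + q * b' ^ 2 = 1) :
    rotation a b h * rotation a' b' h' =
      rotation (a * a' - q * (b * b')) (a * b' + b * a') (norm_mul h h') :=
  Subtype.ext (rotationMatrix_mul ..)

theorem one_eq_motion : (1 : Matrix.SpecialLinearGroup (Fin 3) A) =
    motion (q := q) 1 0 0 0 (by simp) :=
  Subtype.ext motionMatrix_one.symm

theorem map_norm {B : Type*} [CommRing B] (φ : A →+* B) {a b : A} (h : a ^ 2 + q * b ^ 2 = 1) :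
    φ a ^ 2 + q * φ b ^ 2 = 1 := by
  simpa using congrArg φ h

theorem map_motionMatrix {B : Type*} [CommRing B] (φ : A →+* B) (a b x y : A) :
    (motionMatrix q a b x y).map φ = motionMatrix q (φ a) (φ b) (φ x) (φ y) := by
  ext i j
  fin_cases i <;> fin_cases j <;> simp [motionMatrix]

theorem map_rotationMatrix {B : Type*} [CommRing B] (φ : A →+* B) (a b : A) :
    (rotationMatrix q a b).map φ = rotationMatrix q (φ a) (φ b) := by
  ext i j
  fin_cases i <;> fin_cases j <;> simp [rotationMatrix]

theorem map_motion {B : Type*} [CommRing B] (φ : A →+* B) (a b x y : A)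
    (h : a ^ 2 + q * b ^ 2 = 1) :
    Matrix.SpecialLinearGroup.map φ (motion a b x y h) =
      motion (φ a) (φ b) (φ x) (φ y) (map_norm φ h) :=
  Subtype.ext (map_motionMatrix ..)

theorem map_rotation {B : Type*} [CommRing B] (φ : A →+* B) (a b : A)
    (h : a ^ 2 + q * b ^ 2 = 1) :
    Matrix.SpecialLinearGroup.map φ (rotation a b h) =
      rotation (φ a) (φ b) (map_norm φ h) :=
  Subtype.ext (map_rotationMatrix ..)

end Motion

/-! ### Semidirect product structure of the motion group -/

variable {K : Type u} [Field K] {q : ℕ}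

theorem isSemidirect :
    (motionGroup K q).IsSemidirect (rotationGroup K q) (translationGroup K q) := by
  intro A _ _
  refine ⟨?_, ?_, ?_, ?_, ?_⟩
  · intro g hg
    obtain ⟨a, b, h, rfl⟩ := mem_rotationGroup.1 hg
    exact mem_motionGroup.2 ⟨_, _, _, _, h, rfl⟩
  · intro g hg
    obtain ⟨x, y, rfl⟩ := mem_translationGroup.1 hg
    exact mem_motionGroup.2 ⟨_, _, _, _, _, rfl⟩
  · intro g hg x hx
    obtain ⟨a, b, x, y, h, rfl⟩ := mem_motionGroup.1 hg
    obtain ⟨x', y', rfl⟩ := mem_translationGroup.1 hx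
    refine mem_translationGroup.2 ⟨a * x' - q * b * y', b * x' + a * y', ?_⟩
    rw [mul_inv_eq_iff_eq_mul, motion_mul, motion_mul, motion_inj]
    refine ⟨?_, ?_, ?_, ?_⟩ <;> ring
  · rw [eq_bot_iff]
    rintro g ⟨hg, hg'⟩
    obtain ⟨a, b, h, rfl⟩ := mem_rotationGroup.1 hg
    obtain ⟨x, y, e⟩ := mem_translationGroup.1 hg'
    rw [motion_inj] at e
    rw [Subgroup.mem_bot, one_eq_motion (q := q), motion_inj]
    exact ⟨e.1, e.2.1, rfl, rfl⟩
  · intro g hg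
    obtain ⟨a, b, x, y, h, rfl⟩ := mem_motionGroup.1 hg
    -- With the rotation on the left, the translation factor is the inverse rotation applied to `(x,
    -- y)`.
    refine ⟨_, mem_rotationGroup.2 ⟨a, b, h, rfl⟩, _,
      mem_translationGroup.2 ⟨a * x + q * b * y, -b * x + a * y, rfl⟩, ?_⟩
    rw [motion_mul, motion_inj]
    refine ⟨?_, ?_, ?_, ?_⟩
    · ring
    · ring
    · linear_combination -x * h
    · linear_combination -y * h

theorem isUnipotent : (translationGroup K q).IsUnipotent := by
  intro g hg
  obtain ⟨x, y, rfl⟩ := mem_translationGroup.1 hg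
  refine ⟨2, ?_⟩
  ext i j
  fin_cases i <;> fin_cases j <;>
    simp [motion, motionMatrix, pow_two, Matrix.mul_apply, Fin.sum_univ_three]

theorem trivialCentralizer : (rotationGroup K q).TrivialCentralizer (translationGroup K q) := by
  intro t ht H
  obtain ⟨a, b, h, rfl⟩ := mem_rotationGroup.1 ht
  have := H _ (mem_translationGroup.2 ⟨1, 0, rfl⟩)
  rw [motion_mul, motion_mul, motion_inj] at this
  rw [one_eq_motion (q := q), motion_inj]
  simpa using this.2.2

/-- The upper left block of a motion, as a homomorphism on the rotations. -/
def rotationGroupHom (q : ℕ) (A : Type u) [CommRing A] [Algebra K A] :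
    (rotationGroup K q).points A →* (soForm K q).points A where
  toFun g := ⟨rotation (q := q) (g.1.1 0 0) (g.1.1 1 0) (by
    obtain ⟨a, b, h, e⟩ := mem_rotationGroup.1 g.2
    rw [e]
    exact h), mem_soForm.2 ⟨_, _, _, rfl⟩⟩
  map_one' := Subtype.ext (Subtype.ext rotationMatrix_one)
  map_mul' := by
    rintro ⟨g, hg⟩ ⟨g', hg'⟩
    obtain ⟨a, b, h, rfl⟩ := mem_rotationGroup.1 hg
    obtain ⟨a', b', h', rfl⟩ := mem_rotationGroup.1 hg'
    refine Subtype.ext (Eq.trans ?_ (rotation_mul h h').symm)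
    have := motion_mul (x := 0) (y := 0) (x' := 0) (y' := 0) h h'
    refine Subtype.ext ?_
    change rotationMatrix q ((motion a b 0 0 h * motion a' b' 0 0 h').1 0 0)
      ((motion a b 0 0 h * motion a' b' 0 0 h').1 1 0) = rotationMatrix q _ _
    rw [this]
    rfl

theorem rotationGroupHom_bijective (A : Type u) [CommRing A] [Algebra K A] :
    Function.Bijective (rotationGroupHom (K := K) q A) := by
  constructor
  · rintro ⟨g, hg⟩ ⟨g', hg'⟩ e
    obtain ⟨a, b, h, rfl⟩ := mem_rotationGroup.1 hg
    obtain ⟨a', b', h', rfl⟩ := mem_rotationGroup.1 hg'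
    have e' : rotationMatrix q a b = rotationMatrix q a' b' :=
      congrArg (fun g => g.1.1) e
    refine Subtype.ext ((motion_inj (h := h) (h' := h')).2 ⟨?_, ?_, rfl, rfl⟩)
    · exact congrFun (congrFun e' 0) 0
    · exact congrFun (congrFun e' 1) 0
  · rintro ⟨g, hg⟩
    obtain ⟨a, b, h, rfl⟩ := mem_soForm.1 hg
    exact ⟨⟨_, mem_rotationGroup.2 ⟨a, b, h, rfl⟩⟩, rfl⟩

theorem isIsomorphic : (rotationGroup K q).IsIsomorphic (soForm K q) := by
  refine ⟨fun A _ _ => MulEquiv.ofBijective _ (rotationGroupHom_bijective A), ?_⟩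
  rintro A B _ _ _ _ φ ⟨g, hg⟩
  obtain ⟨a, b, h, rfl⟩ := mem_rotationGroup.1 hg
  have e1 := map_motion (φ : A →+* B) a b 0 0 h
  have e2 := map_rotation (φ : A →+* B) a b h
  refine Subtype.ext (Eq.trans ?_ e2.symm)
  refine Subtype.ext ?_
  change rotationMatrix q ((Matrix.SpecialLinearGroup.map (φ : A →+* B) (motion a b 0 0 h)).1 0 0)
    ((Matrix.SpecialLinearGroup.map (φ : A →+* B) (motion a b 0 0 h)).1 1 0) = rotationMatrix q _ _
  rw [e1]
  rfl

end SOForm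

/-! ### Irreducibility, and zeros of polynomials along rational curves -/

namespace Zariski

/-- The hypothesis is irreducibility: two nonempty basic open subsets always meet. This excludes any
cover by two proper closed subsets, disjoint or not. -/
theorem connected_of_forall_exists {X σ k : Type*} [CommRing k] {c : X → σ → k} {B : Set X}
    (hB : B.Nonempty)
    (H : ∀ f g : MvPolynomial σ k, (∃ x ∈ B, MvPolynomial.eval (c x) f ≠ 0) →
      (∃ x ∈ B, MvPolynomial.eval (c x) g ≠ 0) →
      ∃ x ∈ B, MvPolynomial.eval (c x) f ≠ 0 ∧ MvPolynomial.eval (c x) g ≠ 0) :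
    Connected c B := by
  refine ⟨hB, ?_⟩
  rintro _ _ ⟨P, rfl⟩ ⟨Q, rfl⟩ h -
  by_contra! hPQ
  obtain ⟨⟨x, hx, hxP⟩, ⟨y, hy, hyQ⟩⟩ := hPQ.imp Set.not_subset.1 Set.not_subset.1
  simp only [Set.mem_ofPred_eq, not_forall] at hxP hyQ
  obtain ⟨f, hf, hfx⟩ := hxP
  obtain ⟨g, hg, hgy⟩ := hyQ
  obtain ⟨z, hz, hzf, hzg⟩ := H f g ⟨x, hx, hfx⟩ ⟨y, hy, hgy⟩
  rcases h hz with h | h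
  exacts [hzf (h f hf), hzg (h g hg)]

end Zariski

section Zeros

variable {k : Type*} [Field k]

/-- Here `c` is a curve with coordinate ring `R`, and the `φ x` evaluate at its points. Restricted
to the curve, `f` is an element of `R`, nonzero because it is nonzero at `x₀`. It is applied with
`R` a polynomial or Laurent polynomial ring. -/
theorem MvPolynomial.finite_zeros_of_ne_zero {σ R X : Type*} [CommRing R] [Algebra k R]
    (φ : X → R →+* k) (hk : ∀ x a, φ x (algebraMap k R a) = a)
    (hφ : ∀ p ≠ 0, {x | φ x p = 0}.Finite) (c : σ → R)
    (f : MvPolynomial σ k) {x₀ : X} (h : MvPolynomial.eval (fun s => φ x₀ (c s)) f ≠ 0) :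
    {x | MvPolynomial.eval (fun s => φ x (c s)) f = 0}.Finite := by
  have e : ∀ x, MvPolynomial.eval (fun s => φ x (c s)) f = φ x (MvPolynomial.aeval c f) := fun x => by
    rw [MvPolynomial.map_aeval, show (φ x).comp (algebraMap k R) = RingHom.id k from
      RingHom.ext (hk x)]
    rfl
  simp only [e] at h ⊢
  exact hφ _ fun h0 => h (by rw [h0, map_zero])

theorem LaurentPolynomial.finite_zeros {p : LaurentPolynomial k} (hp : p ≠ 0) :
    {z : kˣ | LaurentPolynomial.eval₂ (RingHom.id k) z p = 0}.Finite := by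
  obtain ⟨n, f, hf⟩ := p.exists_T_pow
  have hf0 : f ≠ 0 := by
    rintro rfl
    rw [map_zero] at hf
    exact hp ((LaurentPolynomial.isUnit_T (R := k) n).mul_left_eq_zero.1 hf.symm)
  refine ((f.rootSet_finite k).preimage (Units.val_injective.injOn)).subset fun z hz => ?_
  rw [Set.mem_preimage, Polynomial.mem_rootSet]
  refine ⟨hf0, ?_⟩
  have := congrArg (LaurentPolynomial.eval₂ (RingHom.id k) z) hf
  rw [LaurentPolynomial.eval₂_toLaurent, map_mul, show _ = (0 : k) from hz, zero_mul] at this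
  exact this

theorem Polynomial.finite_zeros {p : Polynomial k} (hp : p ≠ 0) :
    {z : k | Polynomial.evalRingHom z p = 0}.Finite := by
  refine (p.rootSet_finite k).subset fun z hz => ?_
  rw [Polynomial.mem_rootSet]
  exact ⟨hp, by simpa using hz⟩

theorem Polynomial.finite_zeros_eval {σ : Type*} (c : σ → Polynomial k) (f : MvPolynomial σ k)
    {s₀ : k} (h : MvPolynomial.eval (fun j => Polynomial.evalRingHom s₀ (c j)) f ≠ 0) :
    {s : k | MvPolynomial.eval (fun j => Polynomial.evalRingHom s (c j)) f = 0}.Finite := by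
  have h1 : ∀ s a : k, Polynomial.evalRingHom s (algebraMap k (Polynomial k) a) = a := fun s a => by
    rw [← Polynomial.C_eq_algebraMap]
    exact Polynomial.eval_C
  have h2 : ∀ p : Polynomial k, p ≠ 0 → {s : k | Polynomial.evalRingHom s p = 0}.Finite :=
    fun p hp => Polynomial.finite_zeros hp
  exact MvPolynomial.finite_zeros_of_ne_zero (k := k) (R := Polynomial k) (X := k)
    Polynomial.evalRingHom h1 h2 c f (x₀ := s₀) h

end Zeros

/-! ### Parametrization of rotations by their eigenvalue; connectedness and diagonalization -/

namespace SOForm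

section Parametrization

variable {k : Type*} [Field k] {q : ℕ} {r : k}

/-- The first coordinate of the rotation with eigenvalues `z` and `z⁻¹`. -/
def cosine (z : kˣ) : k := (z + z⁻¹) / 2

/-- The second coordinate of the rotation with eigenvalues `z` and `z⁻¹`, where `r² = -q`. -/
def sine (r : k) (z : kˣ) : k := (z - z⁻¹) / (2 * r)

theorem root_ne_zero [CharZero k] (hq : q ≠ 0) (hr : r ^ 2 = -q) : r ≠ 0 := by
  rintro rfl
  exact hq (by simpa using hr)

theorem norm_cosine_sine [CharZero k] (hq : q ≠ 0) (hr : r ^ 2 = -q) (z : kˣ) :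
    cosine z ^ 2 + q * sine r z ^ 2 = 1 := by
  have h0 := root_ne_zero hq hr
  have h1 : (z : k) * ((z⁻¹ : kˣ) : k) = 1 := z.mul_inv
  rw [cosine, sine, div_pow, div_pow, mul_pow, hr, show (q : k) = - r ^ 2 by rw [hr, neg_neg], neg_neg]
  field_simp
  linear_combination 4 * h1

/-- The eigenvalue is `z = a + r b`, with inverse `a - r b`, because `a² + q b² = (a + r b)(a - r
b)`. -/
theorem exists_cosine_sine [CharZero k] (hq : q ≠ 0) (hr : r ^ 2 = -q) {a b : k} (h : a ^ 2 + q * b ^ 2 = 1) :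
    ∃ z : kˣ, (z : k) = a + r * b ∧ cosine z = a ∧ sine r z = b := by
  have h0 := root_ne_zero hq hr
  have h1 : (a + r * b) * (a - r * b) = 1 := by linear_combination h - b ^ 2 * hr
  refine ⟨⟨a + r * b, a - r * b, h1, (mul_comm _ _).trans h1⟩, rfl, ?_, ?_⟩
  · change (a + r * b + (a - r * b)) / 2 = a
    ring
  · change (a + r * b - (a - r * b)) / (2 * r) = b
    field_simp
    ring

open LaurentPolynomial in
theorem finite_zeros_cosine_sine {σ : Type*} (c : σ → MvPolynomial (Fin 2) k) (r : k)
    (f : MvPolynomial σ k) {z₀ : kˣ}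
    (h : MvPolynomial.eval (fun s => MvPolynomial.eval ![cosine z₀, sine r z₀] (c s)) f ≠ 0) :
    {z : kˣ | MvPolynomial.eval
      (fun s => MvPolynomial.eval ![cosine z, sine r z] (c s)) f = 0}.Finite := by
  let u : Fin 2 → LaurentPolynomial k := ![C (1 / 2) * (T 1 + T (-1)), C (1 / (2 * r)) * (T 1 - T (-1))]
  have e : ∀ z : kˣ, (fun s => MvPolynomial.eval ![cosine z, sine r z] (c s)) =
      fun s => eval₂ (RingHom.id k) z (MvPolynomial.aeval u (c s)) := fun z => by
    funext s
    rw [MvPolynomial.map_aeval, show (eval₂ (RingHom.id k) z).comp (algebraMap k k[T;T⁻¹]) =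
      RingHom.id k from RingHom.ext fun a => eval₂_C ..]
    change _ = MvPolynomial.eval _ (c s)
    congr 2
    funext i
    fin_cases i
    · simp [u, cosine, div_eq_inv_mul]
    · simp [u, sine, div_eq_inv_mul]
  simp only [e] at h ⊢
  exact MvPolynomial.finite_zeros_of_ne_zero (fun z => eval₂ (RingHom.id k) z)
    (fun z a => eval₂_C ..) (fun p hp => finite_zeros hp) _ f h

theorem finite_zeros_motion (x y r : k) (f : MvPolynomial (Fin 3 × Fin 3) k) {z₀ : kˣ}
    (h : MvPolynomial.eval (entries (motionMatrix q (cosine z₀) (sine r z₀) x y)) f ≠ 0) :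
    {z : kˣ | MvPolynomial.eval
      (entries (motionMatrix q (cosine z) (sine r z) x y)) f = 0}.Finite := by
  let c : Fin 3 × Fin 3 → MvPolynomial (Fin 2) k :=
    entries (motionMatrix q (.X 0) (.X 1) (.C x) (.C y))
  have e : ∀ z : kˣ, entries (motionMatrix q (cosine z) (sine r z) x y) =
      fun s => MvPolynomial.eval ![cosine z, sine r z] (c s) := fun z => by
    have := map_motionMatrix (q := q) (MvPolynomial.eval ![cosine z, sine r z])
      (.X 0) (.X 1) (.C x) (.C y)
    simp only [MvPolynomial.eval_X, MvPolynomial.eval_C] at this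
    exact congrArg entries this.symm
  simp only [e] at h ⊢
  exact finite_zeros_cosine_sine c r f h

theorem finite_zeros_rotation (r : k) (f : MvPolynomial (Fin 2 × Fin 2) k) {z₀ : kˣ}
    (h : MvPolynomial.eval (entries (rotationMatrix q (cosine z₀) (sine r z₀))) f ≠ 0) :
    {z : kˣ | MvPolynomial.eval
      (entries (rotationMatrix q (cosine z) (sine r z))) f = 0}.Finite := by
  let c : Fin 2 × Fin 2 → MvPolynomial (Fin 2) k := entries (rotationMatrix q (.X 0) (.X 1))
  have e : ∀ z : kˣ, entries (rotationMatrix q (cosine z) (sine r z)) =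
      fun s => MvPolynomial.eval ![cosine z, sine r z] (c s) := fun z => by
    have := map_rotationMatrix (q := q) (MvPolynomial.eval ![cosine z, sine r z]) (.X 0) (.X 1)
    simp only [MvPolynomial.eval_X] at this
    exact congrArg entries this.symm
  simp only [e] at h ⊢
  exact finite_zeros_cosine_sine c r f h

theorem exists_line (a b x y u w : k) : ∃ c : Fin 3 × Fin 3 → Polynomial k, ∀ s : k,
    entries (motionMatrix q a b (x + s * u) (y + s * w)) =
      fun j => Polynomial.evalRingHom s (c j) := by
  refine ⟨entries (motionMatrix q (.C a) (.C b) (.C x + .C u * .X) (.C y + .C w * .X)),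
    fun s => ?_⟩
  have : (motionMatrix q (.C a) (.C b) (.C x + .C u * .X ) (.C y + .C w * .X)).map
      (Polynomial.evalRingHom s) = motionMatrix q a b (x + s * u) (y + s * w) := by
    rw [map_motionMatrix]
    simp [mul_comm s]
  exact (congrArg entries this).symm

theorem finite_zeros_translation (a b x y u w : k) (f : MvPolynomial (Fin 3 × Fin 3) k) {s₀ : k}
    (h : MvPolynomial.eval (entries (motionMatrix q a b (x + s₀ * u) (y + s₀ * w))) f ≠ 0) :
    {s : k | MvPolynomial.eval
      (entries (motionMatrix q a b (x + s * u) (y + s * w))) f = 0}.Finite := by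
  obtain ⟨c, e⟩ := exists_line (q := q) a b x y u w
  simp only [e] at h ⊢
  exact Polynomial.finite_zeros_eval c f h

end Parametrization

variable {K : Type u} [Field K] [CharZero K] {q : ℕ}

theorem exists_sq_eq_neg (K : Type u) [Field K] (q : ℕ) :
    ∃ r : AlgebraicClosure K, r ^ 2 = -q :=
  IsAlgClosed.exists_pow_nat_eq _ two_pos

theorem infinite_units (k : Type*) [Field k] [Infinite k] : Infinite kˣ := by
  have : Infinite ({0}ᶜ : Set k) := (Set.finite_singleton (0 : k)).infinite_compl.to_subtype
  exact Infinite.of_injective (fun x : ({0}ᶜ : Set k) => Units.mk0 x.1 x.2) fun x y h =>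
    Subtype.ext (Units.mk0_inj _ _ |>.1 h)

theorem soForm_isConnected (hq : q ≠ 0) : (soForm K q).IsConnected := by
  obtain ⟨r, hr⟩ := exists_sq_eq_neg K q
  refine Zariski.connected_of_forall_exists ⟨1, one_mem _⟩ ?_
  rintro f g ⟨_, hx, hf⟩ ⟨_, hy, hg⟩
  obtain ⟨a, b, h, rfl⟩ := mem_soForm.1 hx
  obtain ⟨a', b', h', rfl⟩ := mem_soForm.1 hy
  obtain ⟨z, -, rfl, rfl⟩ := exists_cosine_sine hq hr h
  obtain ⟨z', -, rfl, rfl⟩ := exists_cosine_sine hq hr h'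
  have := infinite_units (AlgebraicClosure K)
  obtain ⟨t, ht⟩ := ((finite_zeros_rotation r f hf).union
    (finite_zeros_rotation r g hg)).exists_notMem
  rw [Set.mem_union, not_or] at ht
  exact ⟨_, mem_soForm.2 ⟨_, _, norm_cosine_sine hq hr t, rfl⟩, ht⟩

theorem motionGroup_isConnected (hq : q ≠ 0) : (motionGroup K q).IsConnected := by
  obtain ⟨r, hr⟩ := exists_sq_eq_neg K q
  refine Zariski.connected_of_forall_exists ⟨1, one_mem _⟩ ?_
  rintro f g ⟨_, hx, hf⟩ ⟨_, hy, hg⟩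
  obtain ⟨a, b, x, y, h, rfl⟩ := mem_motionGroup.1 hx
  obtain ⟨a', b', x', y', h', rfl⟩ := mem_motionGroup.1 hy
  obtain ⟨z, -, rfl, rfl⟩ := exists_cosine_sine hq hr h
  obtain ⟨z', -, rfl, rfl⟩ := exists_cosine_sine hq hr h'
  have := infinite_units (AlgebraicClosure K)
  -- First a common rotation is found, with the two translation parts kept; then both polynomials
  -- are restricted to the line joining these translation parts.
  obtain ⟨t, ht⟩ := ((finite_zeros_motion x y r f hf).union
    (finite_zeros_motion x' y' r g hg)).exists_notMem
  rw [Set.mem_union, not_or] at ht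
  have h0 := finite_zeros_translation (q := q) (cosine t) (sine r t) x y (x' - x) (y' - y) f (s₀ := 0)
    (by simpa using ht.1)
  have h1 := finite_zeros_translation (q := q) (cosine t) (sine r t) x y (x' - x) (y' - y) g (s₀ := 1)
    (by simpa using ht.2)
  obtain ⟨s, hs⟩ := (h0.union h1).exists_notMem
  rw [Set.mem_union, not_or] at hs
  exact ⟨_, mem_motionGroup.2 ⟨_, _, _, _, norm_cosine_sine hq hr t, rfl⟩, hs⟩

theorem soForm_isTorus (hq : q ≠ 0) : (soForm K q).IsTorus := by
  refine ⟨soForm_isConnected hq, ?_⟩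
  obtain ⟨r, hr⟩ := exists_sq_eq_neg K q
  have hr0 := root_ne_zero hq hr
  -- The rows `(1, ±r)` are left eigenvectors of every rotation `(a, b)`, with eigenvalues `a ± r
  -- b`.
  let P : Matrix (Fin 2) (Fin 2) (AlgebraicClosure K) := !![1, r; 1, -r]
  have hP : P * ((2 * r)⁻¹ • !![r, r; 1, -1]) = 1 := by
    ext i j
    fin_cases i <;> fin_cases j <;> simp [P, Matrix.mul_apply, Fin.sum_univ_two] <;> field_simp <;>
      ring
  refine ⟨⟨P, _, hP, mul_eq_one_comm.1 hP⟩, ?_⟩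
  intro g hg
  obtain ⟨a, b, h, rfl⟩ := mem_soForm.1 hg
  change (P * rotationMatrix q a b * ((2 * r)⁻¹ • !![r, r; 1, -1])).IsDiag
  have hq' : (q : AlgebraicClosure K) = -r ^ 2 := by rw [hr, neg_neg]
  intro i j hij
  fin_cases i <;> fin_cases j <;>
    simp [P, rotationMatrix, hq', Matrix.mul_apply, Fin.sum_univ_two] at hij ⊢ <;> ring

/-! ### Characters of the torus -/

open LaurentPolynomial in
theorem exists_zpow_of_monoidHom {L : Type*} [Field L] (p : LaurentPolynomial L) (F : Lˣ →* L)
    (hF : ∀ z, F z = eval₂ (RingHom.id L) z p) : ∃ n : ℤ, ∀ z : Lˣ, F z = ((z ^ n : Lˣ) : L) := by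
  let χ : ℤ → (Lˣ →* L) := fun n => (Units.coeHom L).comp (zpowGroupHom n)
  have h : ∀ p : LaurentPolynomial L, (fun z => eval₂ (RingHom.id L) z p) ∈
      Submodule.span L ((fun f : Lˣ →* L => (f : Lˣ → L)) '' Set.range χ) := fun p => by
    induction p using LaurentPolynomial.induction_on' with
    | add p p' hp hp' =>
      simp only [map_add]
      exact Submodule.add_mem _ hp hp'
    | C_mul_T n a =>
      have := Submodule.smul_mem _ a (Submodule.subset_span (R := L)
        (Set.mem_image_of_mem (fun f : Lˣ →* L => (f : Lˣ → L)) (Set.mem_range_self (f := χ) n)))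
      convert this using 1
      funext z
      simp [χ]
  have hFp : (F : Lˣ → L) = fun z => eval₂ (RingHom.id L) z p := funext hF
  by_contra! H
  -- As a Laurent polynomial, `F` is a linear combination of the powers `z ↦ z ^ n`. By Dedekind's
  -- independence of characters it must be one of them.
  refine (linearIndependent_monoidHom Lˣ L).notMem_span_image (s := Set.range χ) (x := F) ?_
    (hFp ▸ h p)
  rintro ⟨n, rfl⟩
  obtain ⟨z, hz⟩ := H n
  exact hz rfl

section Anisotropic

variable {K : Type u} [Field K] [CharZero K] {q : ℕ}

theorem cosine_mul {r : K} (hr : r ^ 2 = -q) (hr0 : r ≠ 0) (z w : Kˣ) :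
    cosine (z * w) = cosine z * cosine w - q * (sine r z * sine r w) := by
  rw [← neg_neg (q : K), ← hr, cosine, cosine, cosine, sine, sine, mul_inv]
  push_cast
  field_simp
  ring

theorem sine_mul {r : K} (hr0 : r ≠ 0) (z w : Kˣ) :
    sine r (z * w) = cosine z * sine r w + sine r z * cosine w := by
  rw [cosine, cosine, sine, sine, sine, mul_inv]
  push_cast
  field_simp
  ring

end Anisotropic

/-- The generic point of the torus `x² + q y² = 1`, where `r² = -q`. -/
noncomputable def genericPoint {L : Type*} [Field L] (r : L) : Fin 2 → LaurentPolynomial L :=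
  ![LaurentPolynomial.C (1 / 2) * (LaurentPolynomial.T 1 + LaurentPolynomial.T (-1)),
    LaurentPolynomial.C (1 / (2 * r)) * (LaurentPolynomial.T 1 - LaurentPolynomial.T (-1))]

section Anisotropic

variable {K L : Type*} [Field K] [Field L] [Algebra K L] {q : ℕ} {r : L}

open LaurentPolynomial in
theorem eval₂_genericPoint {B : Type*} [CommRing B] [Algebra K B] (φ : L →ₐ[K] B) (z : Bˣ) (r : L)
    (χ : MvPolynomial (Fin 2) K) :
    eval₂ (φ : L →+* B) z (MvPolynomial.aeval (genericPoint r) χ) =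
      MvPolynomial.aeval ![φ (1 / 2) * (z + (z⁻¹ : Bˣ)), φ (1 / (2 * r)) * (z - (z⁻¹ : Bˣ))] χ := by
  rw [MvPolynomial.map_aeval, show (eval₂ (φ : L →+* B) z).comp (algebraMap K L[T;T⁻¹]) =
    algebraMap K B from RingHom.ext fun a => ?_]
  · rw [MvPolynomial.aeval_def, MvPolynomial.coe_eval₂Hom]
    congr 1
    funext i
    fin_cases i
    · simp [genericPoint]
    · simp [genericPoint]
  · change eval₂ (φ : L →+* B) z (C (algebraMap K L a)) = _
    simp

/-- Over `L` the torus is split and `χ` becomes some `z ↦ z ^ n`. Since `χ` has coefficients in `K`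
and `τ r = -r`, applying `τ` at a `τ`-fixed `z` replaces `z` by `z⁻¹`, which forces `n = 0`.
Equality holds for Laurent polynomials, not only for values, so that it can be specialized in any
algebra. -/
theorem aeval_genericPoint_eq_one [CharZero L] (hq : q ≠ 0) (hr : r ^ 2 = -q) (τ : L →ₐ[K] L)
    (hτ : τ r = -r) (χ : MvPolynomial (Fin 2) K) (h1 : MvPolynomial.aeval ![(1 : L), 0] χ = 1)
    (hmul : ∀ a b a' b' : L, a ^ 2 + q * b ^ 2 = 1 → a' ^ 2 + q * b' ^ 2 = 1 →
      MvPolynomial.aeval ![a * a' - q * (b * b'), a * b' + b * a'] χ =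
        MvPolynomial.aeval ![a, b] χ * MvPolynomial.aeval ![a', b'] χ) :
    MvPolynomial.aeval (genericPoint r) χ = 1 := by
  have hr0 := root_ne_zero hq hr
  let F : Lˣ →* L :=
    { toFun := fun z => MvPolynomial.aeval ![cosine z, sine r z] χ
      map_one' := by
        rw [← h1]
        congr 2
        simp [cosine, sine]
      map_mul' := fun z w => by
        rw [← hmul _ _ _ _ (norm_cosine_sine hq hr z) (norm_cosine_sine hq hr w),
          cosine_mul hr hr0, sine_mul hr0] }
  have hF : ∀ z, F z = LaurentPolynomial.eval₂ (RingHom.id L) z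
      (MvPolynomial.aeval (genericPoint r) χ) := fun z => by
    refine Eq.trans ?_ (eval₂_genericPoint (AlgHom.id K L) z r χ).symm
    change MvPolynomial.aeval ![cosine z, sine r z] χ = _
    congr 3
    · simp [cosine, div_eq_inv_mul]
    · simp [sine, div_eq_inv_mul]
  obtain ⟨n, hn⟩ := exists_zpow_of_monoidHom _ F hF
  have hn0 : n = 0 := by
    -- The test point `z = 2` is fixed by `τ` and has infinite order, so `2 ^ n = 2 ^ (-n)` gives `n
    -- = 0`.
    let t : Lˣ := Units.mk0 2 two_ne_zero
    have e1 : τ (F t) = F t⁻¹ := by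
      change τ (MvPolynomial.aeval _ χ) = MvPolynomial.aeval _ χ
      rw [← AlgHom.comp_apply, MvPolynomial.comp_aeval]
      congr 2
      funext i
      have h2 : τ 2 = 2 := map_ofNat τ 2
      fin_cases i
      · simp [cosine, t, h2, add_comm]
      · simp [sine, t, hτ, h2]
        field_simp
        ring
    rw [hn, hn, inv_zpow] at e1
    simp only [t, Units.val_zpow_eq_zpow_val, Units.val_mk0, map_zpow₀, map_ofNat,
      Units.val_inv_eq_inv_val] at e1
    have e2 : ((2 : ℚ) ^ n : ℚ) = (2 ^ n)⁻¹ := by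
      have : (((2 : ℚ) ^ n : ℚ) : L) = (((2 ^ n)⁻¹ : ℚ) : L) := by
        push_cast
        exact e1
      exact_mod_cast this
    rw [← zpow_neg] at e2
    have := zpow_right_injective₀ (a := (2 : ℚ)) (by norm_num) (by norm_num) e2
    omega
  by_contra hf
  have := infinite_units L
  refine Set.infinite_univ ((LaurentPolynomial.finite_zeros (sub_ne_zero.2 hf)).subset ?_)
  intro z _
  change LaurentPolynomial.eval₂ (RingHom.id L) z (_ - 1) = 0
  rw [map_sub, ← hF, hn, hn0, map_one, zpow_zero, Units.val_one, sub_self]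

end Anisotropic

theorem aeval_aeval_entries {K : Type*} [Field K] {n : ℕ} {A : Type*} [CommRing A] [Algebra K A] (v : Fin 2 → A)
    (N : Matrix (Fin n) (Fin n) (MvPolynomial (Fin 2) K))
    (χ : MvPolynomial (Fin n × Fin n) K) :
    MvPolynomial.aeval v (MvPolynomial.aeval (entries N) χ) =
      MvPolynomial.aeval (entries (N.map (MvPolynomial.aeval v))) χ := by
  rw [← AlgHom.comp_apply, MvPolynomial.comp_aeval]
  rfl

variable {K : Type u} [Field K] [CharZero K] {q : ℕ}

open TensorProduct in
/-- A polynomial over `K` in two variables that is multiplicative on `x² + q y² = 1` is constant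
there, if `-q` is not a square in `K`. -/
theorem aeval_eq_one_of_multiplicative (hq : q ≠ 0) (hK : ∀ r : K, r ^ 2 ≠ -q)
    (χ : MvPolynomial (Fin 2) K)
    (h1 : ∀ (A : Type u) [CommRing A] [Algebra K A], MvPolynomial.aeval ![(1 : A), 0] χ = 1)
    (hmul : ∀ (A : Type u) [CommRing A] [Algebra K A] (a b a' b' : A), a ^ 2 + q * b ^ 2 = 1 →
      a' ^ 2 + q * b' ^ 2 = 1 →
      MvPolynomial.aeval ![a * a' - q * (b * b'), a * b' + b * a'] χ =
        MvPolynomial.aeval ![a, b] χ * MvPolynomial.aeval ![a', b'] χ)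
    (A : Type u) [CommRing A] [Algebra K A] (a b : A) (h : a ^ 2 + q * b ^ 2 = 1) :
    MvPolynomial.aeval ![a, b] χ = 1 := by
  obtain ⟨L, _, _, r, hr, τ, hτ⟩ : ∃ (L : Type u) (_ : Field L) (_ : Algebra K L) (r : L),
      r ^ 2 = -q ∧ ∃ τ : L →ₐ[K] L, τ r = -r := by
    let P : Polynomial K := Polynomial.X ^ 2 - Polynomial.C (-q : K)
    have : Fact (Irreducible P) := ⟨X_pow_sub_C_irreducible_of_prime Nat.prime_two hK⟩
    have hr : (AdjoinRoot.root P) ^ 2 = -(q : AdjoinRoot P) := by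
      have h := AdjoinRoot.eval₂_root P
      rw [Polynomial.eval₂_sub, Polynomial.eval₂_pow, Polynomial.eval₂_X, Polynomial.eval₂_C,
        map_neg, map_natCast] at h
      exact sub_eq_zero.1 h
    refine ⟨AdjoinRoot P, inferInstance, inferInstance, AdjoinRoot.root P, hr,
      AdjoinRoot.liftAlgHom P (Algebra.ofId K _) (-AdjoinRoot.root P) ?_,
      AdjoinRoot.liftAlgHom_root ..⟩
    simp [P, hr]
  have : CharZero L := charZero_of_injective_algebraMap (algebraMap K L).injective
  have hr0 := root_ne_zero hq hr
  have hf := aeval_genericPoint_eq_one hq hr τ hτ χ (h1 L) (hmul L)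
  -- The algebra `A` need not contain a root of `-q`. It embeds in `A ⊗ L`, where `a + r b` is a
  -- unit at which the Laurent identity can be evaluated.
  let j : A →ₐ[K] A ⊗[K] L := Algebra.TensorProduct.includeLeft
  let φ : L →ₐ[K] A ⊗[K] L := Algebra.TensorProduct.includeRight
  have hj : Function.Injective j := Algebra.TensorProduct.includeLeft_injective (S := K)
    (algebraMap K L).injective
  have hz : (j a + φ r * j b) * (j a - φ r * j b) = 1 := by
    have e1 := congrArg j h
    have e2 := congrArg φ hr
    simp only [map_add, map_mul, map_pow, map_natCast, map_one, map_neg] at e1 e2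
    linear_combination e1 - (j b) ^ 2 * e2
  have := eval₂_genericPoint φ ⟨_, _, hz, (mul_comm _ _).trans hz⟩ r χ
  rw [hf, map_one] at this
  apply hj
  rw [map_one, this, ← AlgHom.comp_apply, MvPolynomial.comp_aeval]
  congr 2
  funext i
  have h2 : φ (1 / 2) * 2 = 1 := by
    rw [← map_ofNat φ 2, ← map_mul, one_div_mul_cancel two_ne_zero, map_one]
  have h3 : φ (1 / (2 * r)) * (2 * φ r) = 1 := by
    rw [← map_ofNat φ 2, ← map_mul, ← map_mul, one_div_mul_cancel (by simpa using hr0), map_one]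
  fin_cases i
  · change j a = φ (1 / 2) * (j a + φ r * j b + (j a - φ r * j b))
    linear_combination -(j a) * h2
  · change j b = φ (1 / (2 * r)) * (j a + φ r * j b - (j a - φ r * j b))
    linear_combination -(j b) * h3

theorem soForm_isAnisotropic (hq : q ≠ 0) (hK : ∀ r : K, r ^ 2 ≠ -q) :
    (soForm K q).IsAnisotropic := by
  intro χ hχ A _ _ g hg
  obtain ⟨a, b, h, rfl⟩ := mem_soForm.1 hg
  obtain ⟨ψ, e⟩ : ∃ ψ : MvPolynomial (Fin 2) K, ∀ (A : Type u) [CommRing A] [Algebra K A] (a b : A),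
      MvPolynomial.aeval ![a, b] ψ =
        MvPolynomial.aeval (entries (rotationMatrix q a b)) χ := by
    refine ⟨MvPolynomial.aeval (entries (rotationMatrix q (.X 0) (.X 1))) χ, fun A _ _ a b => ?_⟩
    rw [aeval_aeval_entries]
    congr 3
    refine (map_rotationMatrix (MvPolynomial.aeval ![a, b] : _ →ₐ[K] A).toRingHom _ _).trans ?_
    simp
  refine (e A a b).symm.trans (aeval_eq_one_of_multiplicative hq hK ψ ?_ ?_ A a b h)
  · intro A _ _
    have h1 := (hχ A).1
    rw [← rotationMatrix_one (q := q)] at h1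
    exact (e A 1 0).trans h1
  · intro A _ _ a b a' b' h h'
    rw [e, e, e, ← rotationMatrix_mul]
    exact (hχ A).2 (rotation a b h) (mem_soForm.2 ⟨a, b, h, rfl⟩) (rotation a' b' h')
      (mem_soForm.2 ⟨a', b', h', rfl⟩)

/-- Rotations suffice for membership in `G_S^*`, because the element exhibited there has no
translation part. -/
theorem aeval_character_rotation (hq : q ≠ 0) (hK : ∀ r : K, r ^ 2 ≠ -q)
    {χ : MvPolynomial (Fin 3 × Fin 3) K} (hχ : (motionGroup K q).IsCharacter χ)
    (A : Type u) [CommRing A] [Algebra K A] (a b : A) (h : a ^ 2 + q * b ^ 2 = 1) :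
    MvPolynomial.aeval (entries (motionMatrix q a b 0 0)) χ = 1 := by
  obtain ⟨ψ, e⟩ : ∃ ψ : MvPolynomial (Fin 2) K, ∀ (A : Type u) [CommRing A] [Algebra K A] (a b : A),
      MvPolynomial.aeval ![a, b] ψ =
        MvPolynomial.aeval (entries (motionMatrix q a b 0 0)) χ := by
    refine ⟨MvPolynomial.aeval (entries (motionMatrix q (.X 0) (.X 1) 0 0)) χ, fun A _ _ a b => ?_⟩
    rw [aeval_aeval_entries]
    congr 3
    refine (map_motionMatrix (MvPolynomial.aeval ![a, b] : _ →ₐ[K] A).toRingHom _ _ _ _).trans ?_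
    simp
  refine (e A a b).symm.trans (aeval_eq_one_of_multiplicative hq hK ψ ?_ ?_ A a b h)
  · intro A _ _
    have h1 := (hχ A).1
    rw [← motionMatrix_one (q := q)] at h1
    exact (e A 1 0).trans h1
  · intro A _ _ a b a' b' h h'
    have := motionMatrix_mul (q := q) a b 0 0 a' b' 0 0
    simp only [mul_zero, sub_zero, add_zero] at this
    rw [e, e, e, ← this]
    exact (hχ A).2 (motion a b 0 0 h) (mem_motionGroup.2 ⟨a, b, 0, 0, h, rfl⟩)
      (motion a' b' 0 0 h') (mem_motionGroup.2 ⟨a', b', 0, 0, h', rfl⟩)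

end SOForm

/-! ### Arithmetic of the biquadratic field -/

theorem Complex.conj_eq_self_of_sq_eq_natCast {w : ℂ} {p : ℕ} (h : w ^ 2 = p) :
    starRingEnd ℂ w = w := by
  rw [Complex.conj_eq_iff_im]
  have h1 := congrArg Complex.re h
  have h2 := congrArg Complex.im h
  simp [pow_two] at h1 h2
  have h2 : w.re * w.im = 0 := by linarith
  rcases mul_eq_zero.1 h2 with h2 | h2
  · have : (0 : ℝ) ≤ p := Nat.cast_nonneg p
    rw [h2] at h1
    nlinarith
  · exact h2

theorem Complex.eq_I_or_of_sq_eq_neg_one {w : ℂ} (h : w ^ 2 = -1) : w = Complex.I ∨ w = -Complex.I :=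
  sq_eq_sq_iff_eq_or_eq_neg.1 (by rw [h, Complex.I_sq])

theorem Rat.sq_ne_prime {p : ℕ} (hp : p.Prime) (r : ℚ) : r ^ 2 ≠ p := fun h => by
  have : IsSquare (p : ℚ) := ⟨r, by rw [← h, sq]⟩
  exact hp.prime.not_isSquare (Rat.isSquare_natCast_iff.1 this)

theorem Rat.prime_mul_sq_ne_prime {p q : ℕ} (hp : p.Prime) (hq : q.Prime) (hpq : p ≠ q) (r : ℚ) :
    p * r ^ 2 ≠ q := fun h => by
  have : IsSquare ((p * q : ℕ) : ℚ) := ⟨p * r, by push_cast; rw [← h]; ring⟩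
  obtain ⟨m, hm⟩ := Rat.isSquare_natCast_iff.1 this
  have h1 : p ∣ m := by
    have : p ∣ m * m := ⟨q, hm.symm⟩
    exact (hp.dvd_mul.1 this).elim id id
  obtain ⟨n, rfl⟩ := h1
  have h2 : q = p * (n * n) := by
    have : p * q = p * (p * (n * n)) := by rw [hm]; ring
    exact Nat.eq_of_mul_eq_mul_left hp.pos this
  exact hpq ((Nat.prime_dvd_prime_iff_eq hp hq).1 ⟨_, h2⟩)

section Biquadratic

variable {p q : ℕ} {K : Type u} [Field K] [NumberField K] {i s : K}

/-- One element `y` serves all embeddings at once: on generators conjugation is `i ↦ -i`, `s ↦ s`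
whatever the embedding, since `s` has real images. -/
theorem exists_eq_conj (hi : i ^ 2 = -1) (hs : s ^ 2 = (p : K))
    (hK : IntermediateField.adjoin ℚ {i, s} = ⊤) (x : K) :
    ∃ y : K, ∀ φ : K →+* ℂ, φ y = starRingEnd ℂ (φ x) := by
  have hx : x ∈ IntermediateField.adjoin ℚ {i, s} := hK ▸ IntermediateField.mem_top
  induction hx using IntermediateField.adjoin_induction with
  | mem x hx =>
    rcases hx with rfl | rfl
    · refine ⟨-x, fun φ => ?_⟩
      have : φ x ^ 2 = -1 := by rw [← map_pow, hi, map_neg, map_one]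
      rcases Complex.eq_I_or_of_sq_eq_neg_one this with h | h <;> simp [h]
    · refine ⟨x, fun φ => (Complex.conj_eq_self_of_sq_eq_natCast (p := p) ?_).symm⟩
      rw [← map_pow, hs, map_natCast]
  | algebraMap x => exact ⟨algebraMap ℚ K x, fun φ => by simp⟩
  | add x y _ _ hx hy =>
    obtain ⟨x', hx⟩ := hx
    obtain ⟨y', hy⟩ := hy
    exact ⟨x' + y', fun φ => by rw [map_add, map_add, map_add, hx, hy]⟩
  | inv x _ hx =>
    obtain ⟨x', hx⟩ := hx
    exact ⟨x'⁻¹, fun φ => by rw [map_inv₀, map_inv₀, map_inv₀, hx]⟩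
  | mul x y _ _ hx hy =>
    obtain ⟨x', hx⟩ := hx
    obtain ⟨y', hy⟩ := hy
    exact ⟨x' * y', fun φ => by rw [map_mul, map_mul, map_mul, hx, hy]⟩

theorem exists_rat_coordinates (hi : i ^ 2 = -1) (hs : s ^ 2 = (p : K))
    (hK : IntermediateField.adjoin ℚ {i, s} = ⊤) (x : K) :
    ∃ a b c d : ℚ, x = a + b * i + c * s + d * (i * s) := by
  have hx : x ∈ Algebra.adjoin ℚ {i, s} := by
    rw [← IntermediateField.adjoin_toSubalgebra_of_isAlgebraic
      fun x _ => Algebra.IsAlgebraic.isAlgebraic x, hK]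
    exact IntermediateField.mem_top
  induction hx using Algebra.adjoin_induction with
  | mem x hx =>
    rcases hx with rfl | rfl
    · exact ⟨0, 1, 0, 0, by simp⟩
    · exact ⟨0, 0, 1, 0, by simp⟩
  | algebraMap r => exact ⟨r, 0, 0, 0, by simp⟩
  | add x y _ _ hx hy =>
    obtain ⟨a, b, c, d, rfl⟩ := hx
    obtain ⟨a', b', c', d', rfl⟩ := hy
    refine ⟨a + a', b + b', c + c', d + d', ?_⟩
    push_cast
    ring
  | mul x y _ _ hx hy =>
    obtain ⟨a, b, c, d, rfl⟩ := hx
    obtain ⟨a', b', c', d', rfl⟩ := hy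
    refine ⟨a * a' - b * b' + p * (c * c') - p * (d * d'),
      a * b' + b * a' + p * (c * d') + p * (d * c'),
      a * c' + c * a' - b * d' - d * b', a * d' + d * a' + b * c' + c * b', ?_⟩
    push_cast
    linear_combination (b * b' + (b * d' + d * b') * s + d * d' * s ^ 2) * hi +
      ((c * c' + (c * d' + d * c') * i) - d * d') * hs

/-- If `r² = -q`, then `i r` is a square root of `q`, hence real, and lies in the real part `ℚ + ℚ
s` of `K`. Squaring `a + c s` would make `q` or `p q` a square in `ℚ`, or `s` rational. -/
theorem sq_ne_neg_prime (hp : p.Prime) (hq : q.Prime) (hpq : p ≠ q)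
    (hi : i ^ 2 = -1) (hs : s ^ 2 = (p : K))
    (hK : IntermediateField.adjoin ℚ {i, s} = ⊤) (r : K) : r ^ 2 ≠ -q := by
  intro hr
  obtain ⟨a, b, c, d, h⟩ := exists_rat_coordinates hi hs hK (i * r)
  have hr' : (i * r) ^ 2 = q := by rw [mul_pow, hi, hr]; ring
  let φ : K →+* ℂ := Classical.choice inferInstance
  have h1 : starRingEnd ℂ (φ s) = φ s := Complex.conj_eq_self_of_sq_eq_natCast (p := p) (by
    rw [← map_pow, hs, map_natCast])
  have h2 : starRingEnd ℂ (φ (i * r)) = φ (i * r) :=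
    Complex.conj_eq_self_of_sq_eq_natCast (p := q) (by rw [← map_pow, hr', map_natCast])
  have h3 : starRingEnd ℂ (φ i) = -φ i := by
    have : φ i ^ 2 = -1 := by rw [← map_pow, hi, map_neg, map_one]
    rcases Complex.eq_I_or_of_sq_eq_neg_one this with h | h <;> simp [h]
  have h4 : i * r = a + c * s := by
    apply φ.injective
    have e := congrArg φ h
    have e' := h2
    rw [e] at e'
    simp only [map_add, map_mul, map_ratCast, h1, h3] at e e' ⊢
    linear_combination e - e' / 2
  have h5 : ((a ^ 2 + p * c ^ 2 - q : ℚ) : K) + (2 * a * c : ℚ) * s = 0 := by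
    push_cast
    rw [h4] at hr'
    linear_combination hr' - c ^ 2 * hs
  by_cases hac : 2 * a * c = 0
  · rw [hac, Rat.cast_zero, zero_mul, add_zero, Rat.cast_eq_zero] at h5
    rcases mul_eq_zero.1 hac with ha | hc
    · have ha : a = 0 := by simpa using ha
      exact Rat.prime_mul_sq_ne_prime hp hq hpq c (by rw [ha] at h5; linarith)
    · exact Rat.sq_ne_prime hq a (by rw [hc] at h5; linarith)
  · refine Rat.sq_ne_prime hp (-(a ^ 2 + p * c ^ 2 - q) / (2 * a * c)) ?_
    have h6 : s = ((-(a ^ 2 + p * c ^ 2 - q) / (2 * a * c) : ℚ) : K) := by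
      rw [Rat.cast_div, eq_div_iff (by exact_mod_cast hac), Rat.cast_neg]
      linear_combination h5
    rw [h6] at hs
    exact_mod_cast hs

end Biquadratic

/-! ### Finiteness of the products of integral rotations with their conjugates -/

/-- The algebraic integers all of whose conjugates have absolute value at most `1`. -/
def boundedIntegers (K : Type u) [Field K] : Set K :=
  {x | IsIntegral ℤ x ∧ ∀ φ : K →+* ℂ, ‖φ x‖ ≤ 1}

theorem boundedIntegers_finite (K : Type u) [Field K] [NumberField K] :
    (boundedIntegers K).Finite :=
  Embeddings.finite_of_norm_le K ℂ 1

/-- The first number is `|a²| - |-q b²|`, bounded by `|a² + q b²| = 1` through the reverse triangle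
inequality. The second is then bounded by `q β² = 1 - α²`, as `|1 - α²| ≤ 2 ≤ q`. -/
theorem norm_conj_bounds {q : ℕ} (hq : 2 ≤ q) {a b : ℂ} (h : a ^ 2 + q * b ^ 2 = 1) :
    ‖a * starRingEnd ℂ a - q * (b * starRingEnd ℂ b)‖ ≤ 1 ∧
    ‖a * starRingEnd ℂ b + b * starRingEnd ℂ a‖ ≤ 1 := by
  have h1 : ‖a * starRingEnd ℂ a - q * (b * starRingEnd ℂ b)‖ ≤ 1 := by
    have e : a * starRingEnd ℂ a - q * (b * starRingEnd ℂ b) =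
        ((‖a ^ 2‖ - ‖-(q * b ^ 2)‖ : ℝ) : ℂ) := by
      simp [Complex.mul_conj, Complex.normSq_eq_norm_sq]
    rw [e, Complex.norm_real, Real.norm_eq_abs]
    refine (abs_norm_sub_norm_le _ _).trans ?_
    rw [sub_neg_eq_add, h, norm_one]
  refine ⟨h1, ?_⟩
  have h' : starRingEnd ℂ a ^ 2 + q * starRingEnd ℂ b ^ 2 = 1 := by
    simpa using congrArg (starRingEnd ℂ) h
  have h2 : (q : ℂ) * (a * starRingEnd ℂ b + b * starRingEnd ℂ a) ^ 2 =
      1 - (a * starRingEnd ℂ a - q * (b * starRingEnd ℂ b)) ^ 2 := by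
    linear_combination (starRingEnd ℂ a ^ 2 + q * starRingEnd ℂ b ^ 2) * h + h'
  have h3 := congrArg norm h2
  rw [norm_mul, norm_pow, Complex.norm_natCast] at h3
  have h4 : ‖1 - (a * starRingEnd ℂ a - q * (b * starRingEnd ℂ b)) ^ 2‖ ≤ 2 := by
    refine (norm_sub_le _ _).trans ?_
    rw [norm_one, norm_pow]
    have := pow_le_one₀ (n := 2) (norm_nonneg _) h1
    linarith
  have hq' : (2 : ℝ) ≤ q := by exact_mod_cast hq
  by_contra! h5
  nlinarith [norm_nonneg (a * starRingEnd ℂ b + b * starRingEnd ℂ a)]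

theorem exists_boundedIntegers {q : ℕ} (hq : 2 ≤ q) {K : Type u} [Field K] [NumberField K]
    (hK : ∀ x : K, ∃ y : K, ∀ φ : K →+* ℂ, φ y = starRingEnd ℂ (φ x)) {a b : K}
    (ha : IsIntegral ℤ a) (hb : IsIntegral ℤ b) (h : a ^ 2 + q * b ^ 2 = 1) :
    ∃ α ∈ boundedIntegers K, ∃ β ∈ boundedIntegers K, ∀ φ : K →+* ℂ,
      φ α = φ a * starRingEnd ℂ (φ a) - q * (φ b * starRingEnd ℂ (φ b)) ∧
      φ β = φ a * starRingEnd ℂ (φ b) + φ b * starRingEnd ℂ (φ a) := by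
  have hint : ∀ x y : K, IsIntegral ℤ x → (∀ φ : K →+* ℂ, φ y = starRingEnd ℂ (φ x)) →
      IsIntegral ℤ y := fun x y hx hy => by
    let φ : K →+* ℂ := Classical.choice inferInstance
    have h1 : IsIntegral ℤ (φ y) := by
      rw [hy]
      exact (hx.map φ.toIntAlgHom).map (starRingEnd ℂ).toIntAlgHom
    exact (isIntegral_algHom_iff φ.toIntAlgHom φ.injective).1 h1
  obtain ⟨a', ha'⟩ := hK a
  obtain ⟨b', hb'⟩ := hK b
  have ia := hint a a' ha ha'
  have ib := hint b b' hb hb'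
  have iq : IsIntegral ℤ (q : K) := isIntegral_natCast q
  have e1 : ∀ φ : K →+* ℂ, φ (a * a' - q * (b * b')) =
      φ a * starRingEnd ℂ (φ a) - q * (φ b * starRingEnd ℂ (φ b)) := fun φ => by
    simp only [map_sub, map_mul, map_natCast, ha', hb']
  have e2 : ∀ φ : K →+* ℂ, φ (a * b' + b * a') =
      φ a * starRingEnd ℂ (φ b) + φ b * starRingEnd ℂ (φ a) := fun φ => by
    simp only [map_add, map_mul, ha', hb']
  have hφ : ∀ φ : K →+* ℂ, φ a ^ 2 + q * φ b ^ 2 = 1 := fun φ => SOForm.map_norm φ h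
  refine ⟨_, ⟨(ha.mul ia).sub (iq.mul (hb.mul ib)), fun φ => ?_⟩, _,
    ⟨(ha.mul ib).add (hb.mul ia), fun φ => ?_⟩, fun φ => ⟨e1 φ, e2 φ⟩⟩
  · rw [e1]
    exact (norm_conj_bounds hq (hφ φ)).1
  · rw [e2]
    exact (norm_conj_bounds hq (hφ φ)).2

/-- The `S_∞`-integral points are those with algebraic integers as entries. -/
theorem LinAlgGroup.mem_sIntegralPoints_empty {K : Type u} [Field K] [NumberField K] {n : ℕ}
    (G : LinAlgGroup K n) (g : G.points K) :
    g ∈ G.sIntegralPoints ∅ ↔ ∀ i j, IsIntegral ℤ (g.1.1 i j) := by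
  have hint : ∀ x : K, x ∈ ((∅ : Finset (HeightOneSpectrum (𝓞 K))) :
      Set (HeightOneSpectrum (𝓞 K))).integer K ↔ IsIntegral ℤ x := fun x => by
    constructor
    · intro hx
      obtain ⟨y, rfl⟩ := HeightOneSpectrum.mem_integers_of_valuation_le_one (R := 𝓞 K) K x
        fun v => hx v (by simp)
      exact RingOfIntegers.isIntegral_coe y
    · intro hx v _
      exact v.valuation_le_one (⟨x, hx⟩ : 𝓞 K)
  constructor
  · rintro ⟨h, hh⟩ i j
    have : g.1.1 i j = (h.1 i j : K) := by
      have := congrArg (fun g => g.1 i j) hh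
      exact this.symm
    rw [this, ← hint]
    exact (h.1 i j).2
  · intro H
    let M : Matrix (Fin n) (Fin n) (((∅ : Finset (HeightOneSpectrum (𝓞 K))) :
      Set (HeightOneSpectrum (𝓞 K))).integer K) := fun i j => ⟨g.1.1 i j, (hint _).2 (H i j)⟩
    have hM : (algebraMap _ K).mapMatrix M = g.1.1 := rfl
    refine ⟨⟨M, ?_⟩, Subtype.ext hM⟩
    apply FaithfulSMul.algebraMap_injective _ K
    rw [RingHom.map_det, hM, g.1.2, map_one]

/-! ### Zariski density of the integral motions -/

namespace SOForm

theorem exists_pell_sequence {q : ℕ} (hq : q.Prime) :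
    ∃ X Y : ℤ → ℤ, (∀ n, X n ^ 2 - q * Y n ^ 2 = 1) ∧ Function.Injective Y := by
  have hq0 : (0 : ℤ) < q := by exact_mod_cast hq.pos
  have hsq : ¬ IsSquare (q : ℤ) := fun h =>
    hq.prime.not_isSquare (Int.isSquare_natCast_iff.1 h)
  obtain ⟨a, ha⟩ := Pell.IsFundamental.exists_of_not_isSquare hq0 hsq
  exact ⟨fun n => (a ^ n).x, fun n => (a ^ n).y, fun n => (a ^ n).prop, ha.y_strictMono.injective⟩

theorem isIntegral_motionMatrix {q : ℕ} {K : Type*} [Field K] {a b x y : K} (ha : IsIntegral ℤ a) (hb : IsIntegral ℤ b)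
    (hx : IsIntegral ℤ x) (hy : IsIntegral ℤ y) (j l : Fin 3) :
    IsIntegral ℤ (motionMatrix q a b x y j l) := by
  have hqb : IsIntegral ℤ ((q : K) * b) := (isIntegral_natCast q).mul hb
  fin_cases j <;> fin_cases l <;>
    simp [motionMatrix, ha, hb, hx, hy, isIntegral_zero, isIntegral_one, hqb.neg]

variable {q : ℕ} {K : Type u} [Field K] [NumberField K] {i : K}

/-- A polynomial nonzero at some motion stays nonzero while the rotation, then `x`, then `y` are
replaced by integral values: each replacement moves along a curve with finitely many zeros and
infinitely many admissible points. -/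
theorem motionGroup_isZariskiDense (hq : q.Prime) (hi : i ^ 2 = -1) :
    (motionGroup K q).IsZariskiDense ∅ := by
  rintro _ ⟨P, rfl⟩ hP g hg f hf
  obtain ⟨a, b, x, y, h, rfl⟩ := mem_motionGroup.1 hg
  obtain ⟨r, hr⟩ := exists_sq_eq_neg K q
  obtain ⟨z₀, -, rfl, rfl⟩ := exists_cosine_sine hq.ne_zero hr h
  by_contra h0
  obtain ⟨X, Y, hXY, hY⟩ := exists_pell_sequence hq
  -- Multiplying `Y` by `i` turns Pell's equation into the norm equation of the torus.
  have hn : ∀ n, (X n : K) ^ 2 + q * (i * Y n) ^ 2 = 1 := fun n => by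
    have : ((X n ^ 2 - q * Y n ^ 2 : ℤ) : K) = 1 := by rw [hXY, Int.cast_one]
    push_cast at this
    rw [mul_pow, hi]
    linear_combination this
  let ι : K →ₐ[K] AlgebraicClosure K := Algebra.ofId K (AlgebraicClosure K)
  have hz : ∀ n, ∃ z : (AlgebraicClosure K)ˣ, cosine z = ι (X n) ∧ sine r z = ι (i * Y n) := fun n =>
    let ⟨z, _, hz⟩ := exists_cosine_sine hq.ne_zero hr (map_norm (ι : K →+* AlgebraicClosure K) (hn n))
    ⟨z, hz⟩
  choose z hzc hzs using hz
  have hi0 : i ≠ 0 := by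
    rintro rfl
    simp at hi
  have hzinj : Function.Injective z := fun n m hnm => by
    have := (hzs n).symm.trans ((congrArg (sine r) hnm).trans (hzs m))
    have := mul_left_cancel₀ hi0 (ι.injective this)
    exact hY (by exact_mod_cast this)
  obtain ⟨n, hn1⟩ := ((finite_zeros_motion x y r f h0).preimage hzinj.injOn).exists_notMem
  have hint : ∀ c : AlgebraicClosure K, Function.Injective fun m : ℤ => (m : AlgebraicClosure K) - c :=
    fun c m m' h => by simpa using h
  have h2 := finite_zeros_translation (cosine (z n)) (sine r (z n)) x y 1 0 f (s₀ := 0) (q := q)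
    (by simpa using hn1)
  obtain ⟨m, hm⟩ := (h2.preimage (hint x).injOn).exists_notMem
  have h3 := finite_zeros_translation (cosine (z n)) (sine r (z n)) m y 0 1 f (s₀ := 0) (q := q)
    (by simpa using hm)
  obtain ⟨m', hm'⟩ := (h3.preimage (hint y).injOn).exists_notMem
  refine hm' ?_
  let g : Matrix.SpecialLinearGroup (Fin 3) K := motion (X n : K) (i * Y n) m m' (hn n)
  have hg : g ∈ (motionGroup K q).points K := mem_motionGroup.2 ⟨_, _, _, _, hn n, rfl⟩
  have hgO : (⟨g, hg⟩ : (motionGroup K q).points K) ∈ (motionGroup K q).sIntegralPoints ∅ := by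
    rw [LinAlgGroup.mem_sIntegralPoints_empty]
    have hii : IsIntegral ℤ i := by
      refine IsIntegral.of_pow two_pos ?_
      rw [hi]
      exact isIntegral_one.neg
    exact isIntegral_motionMatrix (isIntegral_algebraMap (x := X n))
      (hii.mul (isIntegral_algebraMap (x := Y n))) (isIntegral_algebraMap (x := m))
      (isIntegral_algebraMap (x := m'))
  have := hP ⟨_, hgO, rfl⟩ f hf
  have e : ((motionGroup K q).pointsMap ι ⟨g, hg⟩).1.1 =
      motionMatrix q (cosine (z n)) (sine r (z n)) m m' := by
    have := map_motion (ι : K →+* AlgebraicClosure K) (X n : K) (i * Y n) m m' (hn n)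
    refine (congrArg Subtype.val this).trans ?_
    rw [motion, hzc, hzs]
    simp
  change MvPolynomial.eval (entries (motionMatrix q _ _ _ _)) f = 0
  rw [show (m : AlgebraicClosure K) + (m' - y) * 0 = m by ring,
    show y + ((m' : AlgebraicClosure K) - y) * 1 = m' by ring, ← e]
  exact this

end SOForm

/-! ### Zariski closed conditions and stabilizers of finite sets of subspaces -/

namespace Zariski

variable {X σ k : Type*} [CommRing k] {c : X → σ → k}

theorem isClosed_iInter {ι : Sort*} {Z : ι → Set X} (h : ∀ i, IsClosed c (Z i)) :
    IsClosed c (⋂ i, Z i) := by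
  choose P hP using h
  refine ⟨⋃ i, P i, ?_⟩
  ext x
  simp only [hP, Set.mem_iInter, Set.mem_ofPred_eq, Set.mem_iUnion]
  exact ⟨fun h f ⟨i, hf⟩ => h i f hf, fun h i f hf => h f ⟨i, hf⟩⟩

theorem isClosed_empty [Nontrivial k] : IsClosed c ∅ := by
  refine ⟨{1}, ?_⟩
  ext x
  simp

theorem isClosed_setOf_eval_eq_zero (f : MvPolynomial σ k) :
    IsClosed c {x | MvPolynomial.eval (c x) f = 0} :=
  ⟨{f}, by simp⟩

theorem IsClosed.union [NoZeroDivisors k] {Z W : Set X} (hZ : IsClosed c Z) (hW : IsClosed c W) :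
    IsClosed c (Z ∪ W) := by
  obtain ⟨P, rfl⟩ := hZ
  obtain ⟨Q, rfl⟩ := hW
  refine ⟨{h | ∃ f ∈ P, ∃ g ∈ Q, h = f * g}, ?_⟩
  ext x
  constructor
  · rintro (h | h) _ ⟨f, hf, g, hg, rfl⟩
    · rw [map_mul, h f hf, zero_mul]
    · rw [map_mul, h g hg, mul_zero]
  · intro h
    by_contra! hx
    simp only [Set.mem_union, Set.mem_ofPred_eq, not_or, not_forall] at hx
    obtain ⟨⟨f, hf, hfx⟩, ⟨g, hg, hgx⟩⟩ := hx
    have := h _ ⟨f, hf, g, hg, rfl⟩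
    rw [map_mul] at this
    exact (mul_ne_zero hfx hgx) this

theorem isClosed_biUnion [NoZeroDivisors k] [Nontrivial k] {ι : Type*} {s : Set ι} (hs : s.Finite)
    {Z : ι → Set X} (h : ∀ i ∈ s, IsClosed c (Z i)) : IsClosed c (⋃ i ∈ s, Z i) := by
  induction s, hs using Set.Finite.induction_on with
  | empty => simpa using isClosed_empty
  | insert _ _ ih =>
    rw [Set.biUnion_insert]
    exact (h _ (Set.mem_insert _ _)).union (ih fun i hi => h i (Set.mem_insert_of_mem _ hi))

end Zariski

section Stabilizer

variable {d : ℕ} {V : Type*} [AddCommGroup V] [Module ℝ V] (b : Module.Basis (Fin d) ℝ V)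

/-- The action of `GL_d(ℝ)` on a vector space with a basis. -/
noncomputable def glAction : GL (Fin d) ℝ →* Module.End ℝ V :=
  ((LinearMap.toMatrixAlgEquiv b).symm : _ →* Module.End ℝ V).comp (Units.coeHom _)

theorem glAction_apply (M : GL (Fin d) ℝ) (w : V) :
    glAction b M w = ∑ j, (∑ l, M.1 j l * b.repr w l) • b j := by
  change Matrix.toLinAlgEquiv b M.1 w = _
  rw [Matrix.toLinAlgEquiv_apply]
  rfl

theorem isClosed_setOf_map_le (W W' : Submodule ℝ V) :
    Zariski.IsClosed (fun g : GL (Fin d) ℝ => entries g.1) {M | W.map (glAction b M) ≤ W'} := by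
  have e : {M | W.map (glAction b M) ≤ W'} =
      ⋂ (w : W) (l : W'.dualAnnihilator), {M | MvPolynomial.eval (entries M.1)
        (∑ j, (∑ m, MvPolynomial.X (j, m) * MvPolynomial.C (b.repr w m)) *
          MvPolynomial.C (l.1 (b j))) = 0} := by
    ext M
    have h : ∀ (w : W) (l : W'.dualAnnihilator), MvPolynomial.eval (entries M.1)
        (∑ j, (∑ m, MvPolynomial.X (j, m) * MvPolynomial.C (b.repr w m)) *
          MvPolynomial.C (l.1 (b j))) = l.1 (glAction b M w) := fun w l => by
      rw [glAction_apply]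
      simp [entries]
    simp only [Set.mem_iInter, Set.mem_ofPred_eq, h]
    rw [Submodule.map_le_iff_le_comap]
    constructor
    · intro H w l
      exact (Submodule.mem_dualAnnihilator _).1 l.2 _ (H w.2)
    · intro H w hw
      exact (Subspace.forall_mem_dualAnnihilator_apply_eq_zero_iff W' _).1
        fun l hl => H ⟨w, hw⟩ ⟨l, hl⟩
  rw [e]
  exact Zariski.isClosed_iInter fun w => Zariski.isClosed_iInter fun l =>
    Zariski.isClosed_setOf_eval_eq_zero _

theorem glAction_injective (M : GL (Fin d) ℝ) : Function.Injective (glAction b M) := by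
  refine Function.LeftInverse.injective (g := glAction b M⁻¹) fun w => ?_
  rw [← Module.End.mul_apply, ← map_mul, inv_mul_cancel, map_one, Module.End.one_apply]

/-- Invertible maps preserve dimension, so equality is either the linear condition of inclusion or
impossible. -/
theorem isClosed_setOf_map_eq (W W' : Submodule ℝ V) :
    Zariski.IsClosed (fun g : GL (Fin d) ℝ => entries g.1) {M | W.map (glAction b M) = W'} := by
  have : FiniteDimensional ℝ V := b.finiteDimensional_of_finite
  have hfin : ∀ M, Module.finrank ℝ (W.map (glAction b M)) = Module.finrank ℝ W := fun M =>
    ((W.equivMapOfInjective _ (glAction_injective b M)).finrank_eq).symm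
  by_cases h : Module.finrank ℝ W = Module.finrank ℝ W'
  · convert isClosed_setOf_map_le b W W' using 1
    ext M
    exact ⟨fun h => le_of_eq h, fun hle => Submodule.eq_of_le_of_finrank_eq hle ((hfin M).trans h)⟩
  · rw [Set.eq_empty_of_forall_notMem (s := {M | W.map (glAction b M) = W'})]
    · exact Zariski.isClosed_empty
    rintro M rfl
    exact h (hfin M).symm

/-- The group of matrices that permute a finite set of subspaces. -/
noncomputable def subspaceStabilizer {𝒲 : Set (Submodule ℝ V)} (h𝒲 : 𝒲.Finite) :
    Subgroup (GL (Fin d) ℝ) where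
  carrier := {M | ∀ W ∈ 𝒲, W.map (glAction b M) ∈ 𝒲}
  one_mem' W hW := by
    rw [map_one, Module.End.one_eq_id, Submodule.map_id]
    exact hW
  mul_mem' {M N} hM hN W hW := by
    rw [map_mul, Module.End.mul_eq_comp, Submodule.map_comp]
    exact hM _ (hN W hW)
  inv_mem' {M} hM W hW := by
    -- An injective self-map of a finite set is surjective, so the inverse matrix also preserves
    -- `𝒲`.
    have hinj : Set.InjOn (Submodule.map (glAction b M)) 𝒲 :=
      (Submodule.map_injective_of_injective (glAction_injective b M)).injOn
    obtain ⟨W', hW', rfl⟩ :=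
      ((h𝒲.injOn_iff_bijOn_of_mapsTo (f := Submodule.map (glAction b M)) hM).1 hinj).surjOn hW
    rwa [← Submodule.map_comp, ← Module.End.mul_eq_comp, ← map_mul, inv_mul_cancel, map_one,
      Module.End.one_eq_id, Submodule.map_id]

theorem map_mem_of_mem_almostZariskiClosure {𝒲 : Set (Submodule ℝ V)} (h𝒲 : 𝒲.Finite)
    {A : Subgroup (GL (Fin d) ℝ)} (hA : ∀ M ∈ A, ∀ W ∈ 𝒲, W.map (glAction b M) ∈ 𝒲)
    {M : GL (Fin d) ℝ} (hM : M ∈ almostZariskiClosure A) {W : Submodule ℝ V} (hW : W ∈ 𝒲) :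
    W.map (glAction b M) ∈ 𝒲 := by
  have hcl : Zariski.IsClosed (fun g : GL (Fin d) ℝ => entries g.1)
      (subspaceStabilizer b h𝒲 : Set (GL (Fin d) ℝ)) := by
    have e : (subspaceStabilizer b h𝒲 : Set (GL (Fin d) ℝ)) =
        ⋂ W : 𝒲, ⋃ W' ∈ 𝒲, {M | W.1.map (glAction b M) = W'} := by
      ext M
      simp only [Set.mem_iInter, Set.mem_iUnion, Set.mem_ofPred_eq, exists_prop,
        exists_eq_right', Subtype.forall]
      exact Iff.rfl
    rw [e]
    exact Zariski.isClosed_iInter fun W => Zariski.isClosed_biUnion h𝒲 fun W' _ =>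
      isClosed_setOf_map_eq b W.1 W'
  -- A Zariski closed subgroup is almost Zariski closed, with `B` the subgroup itself.
  have h := (Subgroup.mem_sInf.1 hM) (subspaceStabilizer b h𝒲)
    ⟨⟨_, hcl, connectedComponentIn_subset _ _, le_rfl⟩, hA⟩
  exact h W hW

end Stabilizer

theorem NumberField.InfinitePlace.extensionEmbedding_algebraMap {K : Type u} [Field K]
    (v : InfinitePlace K) (x : K) :
    Completion.extensionEmbedding v (algebraMap K v.Completion x) = v.embedding x :=
  Completion.extensionEmbedding_coe (v := v) ((WithAbs.equiv v.1).symm x)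

/-- Solving `a² + q b² = 1`, `a² - q b² = c` over the reals is possible for each `c` in `[-1, 1]`,
an infinite set. -/
theorem exists_real_norm_one_notMem {q : ℕ} (hq : q ≠ 0) {F : Set ℝ} (hF : F.Finite) :
    ∃ a b : ℝ, a ^ 2 + q * b ^ 2 = 1 ∧ a ^ 2 - q * b ^ 2 ∉ F := by
  obtain ⟨c, hc, hcF⟩ := (Set.Icc_infinite (show (-1 : ℝ) < 1 by norm_num)).exists_notMem_finite hF
  have hq' : (0 : ℝ) < q := by exact_mod_cast Nat.pos_of_ne_zero hq
  have ha : √((1 + c) / 2) ^ 2 = (1 + c) / 2 := Real.sq_sqrt (by linarith [hc.1])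
  have hb : √((1 - c) / (2 * q)) ^ 2 = (1 - c) / (2 * q) :=
    Real.sq_sqrt (div_nonneg (by linarith [hc.2]) (by positivity))
  refine ⟨√((1 + c) / 2), √((1 - c) / (2 * q)), ?_, ?_⟩
  · rw [ha, hb]
    field_simp
    ring
  · have e : (1 + c) / 2 - q * ((1 - c) / (2 * q)) = c := by
      field_simp
      ring
    rwa [ha, hb, e]

/-! ### Adjoint action on translations and its twisted real forms -/

namespace SOForm

section Adjoint

/-- The infinitesimal translation by `(x, y)`. -/
def translationMatrix {A : Type*} [CommRing A] (x y : A) : Matrix (Fin 3) (Fin 3) A :=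
  !![0, 0, x; 0, 0, y; 0, 0, 0]

theorem motion_conj_translationMatrix {A : Type*} [CommRing A] {q : ℕ} {a b c d : A}
    (h : a ^ 2 + q * b ^ 2 = 1) (x y : A) :
    (motion a b c d h).1 * translationMatrix x y * ((motion a b c d h)⁻¹).1 =
      translationMatrix (a * x - q * b * y) (b * x + a * y) := by
  rw [motion_inv]
  ext i j
  fin_cases i <;> fin_cases j <;>
    simp [motion, motionMatrix, translationMatrix, Matrix.mul_apply, Fin.sum_univ_three]
  ring

theorem translationMatrix_mem_lieAlg {K : Type u} [Field K] {q : ℕ} {A : Type u} [CommRing A]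
    [Algebra K A] (x y : A) : translationMatrix x y ∈ (motionGroup K q).lieAlg A := by
  refine ⟨motion (q := q) 1 0 (TrivSqZeroExt.inr x) (TrivSqZeroExt.inr y) (by simp),
    mem_motionGroup.2 ⟨_, _, _, _, _, rfl⟩, fun i j => ?_⟩
  fin_cases i <;> fin_cases j <;>
    simp [motion, motionMatrix, translationMatrix, -DualNumber.inr_eq_smul_eps]

open NumberField.InfinitePlace.Completion in
/-- The real form of the Lie algebra of translations that is twisted by the rotation `(α, β)`. -/
def realForm {K : Type u} [Field K] (q : ℕ) (α β : K) : Submodule ℝ (motionGroup K q).lieInfty where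
  -- These are the fixed points of `(α, β) σ` with `σ (x, y) = (x̄, -ȳ)`. The sign in `σ` matters:
  -- plain conjugation would lead to `t t̄⁻¹` in place of `t t̄`, and the argument bounding `t t̄`
  -- would not apply.
  carrier := {X | ∀ v : InfinitePlace K, ∃ x y : v.Completion, X.1 v = translationMatrix x y ∧
    extensionEmbedding v x = v.embedding α * starRingEnd ℂ (extensionEmbedding v x) +
      q * v.embedding β * starRingEnd ℂ (extensionEmbedding v y) ∧
    extensionEmbedding v y = v.embedding β * starRingEnd ℂ (extensionEmbedding v x) -
      v.embedding α * starRingEnd ℂ (extensionEmbedding v y)}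
  zero_mem' v := ⟨0, 0, by
    change (0 : Matrix (Fin 3) (Fin 3) v.Completion) = _
    ext i j
    fin_cases i <;> fin_cases j <;> simp [translationMatrix], by simp, by simp⟩
  add_mem' {X Y} hX hY v := by
    obtain ⟨x, y, h, h1, h2⟩ := hX v
    obtain ⟨x', y', h', h1', h2'⟩ := hY v
    refine ⟨x + x', y + y', ?_, ?_, ?_⟩
    · change X.1 v + Y.1 v = _
      rw [h, h']
      ext i j
      fin_cases i <;> fin_cases j <;> simp [translationMatrix]
    · simp only [map_add]
      linear_combination h1 + h1'
    · simp only [map_add]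
      linear_combination h2 + h2'
  smul_mem' r X hX v := by
    obtain ⟨x, y, h, h1, h2⟩ := hX v
    refine ⟨r • x, r • y, ?_, ?_, ?_⟩
    · change r • X.1 v = _
      rw [h]
      ext i j
      fin_cases i <;> fin_cases j <;> simp [translationMatrix]
    all_goals
      have e : ∀ z : v.Completion, extensionEmbedding v (r • z) = r * extensionEmbedding v z :=
        fun z => by
          rw [Algebra.smul_def, map_mul]
          congr 1
          exact v.extensionEmbedding_realHom r
      simp only [e, map_mul, Complex.conj_ofReal]
    · linear_combination (r : ℂ) * h1
    · linear_combination (r : ℂ) * h2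

variable {K : Type u} [Field K] {q : ℕ}

theorem Ad_apply_translation {g : (motionGroup K q).Infty} {X : (motionGroup K q).lieInfty}
    {v : InfinitePlace K} {a b c d x y : v.Completion} {h : a ^ 2 + q * b ^ 2 = 1}
    (hg : (g v).1 = motion a b c d h) (hX : X.1 v = translationMatrix x y) :
    ((motionGroup K q).Ad g X).1 v =
      translationMatrix (a * x - q * b * y) (b * x + a * y) := by
  change (g v).1.1 * X.1 v * ((g v).1⁻¹).1 = _
  rw [hg, hX]
  exact motion_conj_translationMatrix h x y

theorem glAction_AdMatrix (g : (motionGroup K q).Infty) [NumberField K] :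
    glAction (Module.finBasis ℝ (motionGroup K q).lieInfty) ((motionGroup K q).AdMatrix g) =
      (motionGroup K q).Ad g :=
  (LinearMap.toMatrixAlgEquiv (Module.finBasis ℝ (motionGroup K q).lieInfty)).symm_apply_apply _

-- Conjugating by the rotation part `t` gives `t σ t⁻¹ = t t̄ σ`, and translations act trivially on
-- infinitesimal translations. Surjectivity is obtained by applying the inverse motion.
open NumberField.InfinitePlace.Completion in
theorem map_Ad_realForm {a b c d : K} (h : a ^ 2 + q * b ^ 2 = 1)
    {g : (motionGroup K q).points K} (hg : g.1 = motion a b c d h) {α β : K}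
    (hα : ∀ φ : K →+* ℂ, φ α = φ a * starRingEnd ℂ (φ a) - q * (φ b * starRingEnd ℂ (φ b)))
    (hβ : ∀ φ : K →+* ℂ, φ β = φ a * starRingEnd ℂ (φ b) + φ b * starRingEnd ℂ (φ a)) :
    (realForm q 1 0).map ((motionGroup K q).Ad ((motionGroup K q).diagInfty g)) =
      realForm q α β := by
  have hgv : ∀ v : InfinitePlace K, ((motionGroup K q).diagInfty g v).1 =
      motion _ _ _ _ (map_norm (algebraMap K v.Completion) h) := fun v => by
    refine Eq.trans ?_ (map_motion (algebraMap K v.Completion) a b c d h)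
    exact congrArg (Matrix.SpecialLinearGroup.map (algebraMap K v.Completion)) hg
  have hgv' : ∀ v : InfinitePlace K, (((motionGroup K q).diagInfty g)⁻¹ v).1 = motion _ _ _ _
      (norm_inv (map_norm (algebraMap K v.Completion) h)) := fun v => by
    change (((motionGroup K q).diagInfty g v).1)⁻¹ = _
    rw [hgv, motion_inv]
  have hnorm : ∀ v : InfinitePlace K, v.embedding a ^ 2 + q * v.embedding b ^ 2 = 1 :=
    fun v => map_norm v.embedding h
  have hnorm' : ∀ v : InfinitePlace K, starRingEnd ℂ (v.embedding a) ^ 2 +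
      q * starRingEnd ℂ (v.embedding b) ^ 2 = 1 := fun v => by
    simpa using congrArg (starRingEnd ℂ) (hnorm v)
  apply le_antisymm
  · rintro _ ⟨X, hX, rfl⟩ v
    obtain ⟨x, y, hxy, h1, h2⟩ := hX v
    refine ⟨_, _, Ad_apply_translation (hgv v) hxy, ?_, ?_⟩ <;>
    simp only [map_one, map_zero, one_mul, mul_zero, zero_mul, add_zero, zero_sub, map_sub,
      map_add, map_mul, map_natCast, v.extensionEmbedding_algebraMap, hα, hβ] at h1 h2 ⊢
    · linear_combination v.embedding a * h1 - q * v.embedding b * h2 -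
        (v.embedding a * starRingEnd ℂ (extensionEmbedding v x) + q * v.embedding b * starRingEnd ℂ (extensionEmbedding v y)) * hnorm' v
    · linear_combination v.embedding b * h1 + v.embedding a * h2 -
        (v.embedding b * starRingEnd ℂ (extensionEmbedding v x) - v.embedding a * starRingEnd ℂ (extensionEmbedding v y)) * hnorm' v
  · intro X hX
    refine ⟨(motionGroup K q).Ad ((motionGroup K q).diagInfty g)⁻¹ X, fun v => ?_, ?_⟩
    · obtain ⟨x, y, hxy, h1, h2⟩ := hX v
      refine ⟨_, _, Ad_apply_translation (hgv' v) hxy, ?_, ?_⟩ <;>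
      simp only [map_one, map_zero, one_mul, mul_zero, zero_mul, add_zero, zero_sub, map_sub,
        map_add, map_mul, map_neg, map_natCast, v.extensionEmbedding_algebraMap, hα, hβ] at h1 h2 ⊢
      · linear_combination v.embedding a * h1 + q * v.embedding b * h2 +
          (starRingEnd ℂ (v.embedding a) * starRingEnd ℂ (extensionEmbedding v x) + q * starRingEnd ℂ (v.embedding b) * starRingEnd ℂ (extensionEmbedding v y)) * hnorm v
      · linear_combination -v.embedding b * h1 + v.embedding a * h2 +
          (starRingEnd ℂ (v.embedding b) * starRingEnd ℂ (extensionEmbedding v x) - starRingEnd ℂ (v.embedding a) * starRingEnd ℂ (extensionEmbedding v y)) * hnorm v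
    · rw [← Module.End.mul_apply, ← map_mul, mul_inv_cancel, map_one, Module.End.one_apply]

end Adjoint

/-! ### Failure of real density, and properness of `G_S°` -/

variable {q : ℕ} {K : Type u} [Field K] [NumberField K]

/-- The real numbers `|a|² - q |b|²` at the place `v`, for integral rotations `(a, b)`, belong to
this set. -/
def boundedReals (v : InfinitePlace K) : Set ℝ :=
  (fun x => (v.embedding x).re) '' boundedIntegers K

theorem boundedReals_finite (v : InfinitePlace K) : (boundedReals v).Finite :=
  (boundedIntegers_finite K).image _

open MvPolynomial in
theorem soForm_not_isZariskiDenseInfty (hq : 2 ≤ q)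
    (hK : ∀ x : K, ∃ y : K, ∀ φ : K →+* ℂ, φ y = starRingEnd ℂ (φ x)) :
    ¬ (soForm K q).IsZariskiDenseInfty ∅ := by
  intro H
  let v₀ : InfinitePlace K := Classical.choice inferInstance
  obtain ⟨a, b, hab, hF⟩ := exists_real_norm_one_notMem (q := q) (by omega) (boundedReals_finite v₀)
  -- This is `|a|² - q |b|²` at `v₀`, in real coordinates; the closed set below prescribes its
  -- finitely many values on integral points.
  let f : MvPolynomial (InfinitePlace K × (Fin 2 × Fin 2) × Bool) ℝ :=
    X (v₀, (0, 0), true) ^ 2 + X (v₀, (0, 0), false) ^ 2 -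
      C (q : ℝ) * (X (v₀, (1, 0), true) ^ 2 + X (v₀, (1, 0), false) ^ 2)
  have hf : ∀ (g : ∀ v : InfinitePlace K, Matrix.SpecialLinearGroup (Fin 2) v.Completion) (z w : ℂ),
      InfinitePlace.Completion.extensionEmbedding v₀ ((g v₀).1 0 0) = z →
      InfinitePlace.Completion.extensionEmbedding v₀ ((g v₀).1 1 0) = w →
      eval (LinAlgGroup.realEntries g) f =
        (z * starRingEnd ℂ z - q * (w * starRingEnd ℂ w)).re := by
    rintro g _ _ rfl rfl
    simp [f, LinAlgGroup.realEntries, entries, InfinitePlace.realCoord]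
    ring
  have hcl : Zariski.IsClosed (k := ℝ) LinAlgGroup.realEntries
      (⋃ c ∈ boundedReals v₀, {g | eval (LinAlgGroup.realEntries g) (f - C c) = 0}) :=
    Zariski.isClosed_biUnion (boundedReals_finite v₀) fun c _ =>
      Zariski.isClosed_setOf_eval_eq_zero (f - C c)
  let g : ∀ v : InfinitePlace K, Matrix.SpecialLinearGroup (Fin 2) v.Completion := fun v =>
    rotation (v.realHom a) (v.realHom b) (map_norm v.realHom hab)
  have hg : g ∈ ⋃ c ∈ boundedReals v₀, {g | eval (LinAlgGroup.realEntries g) (f - C c) = 0} := by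
    refine H _ hcl ?_ fun v => mem_soForm.2 ⟨_, _, _, rfl⟩
    rintro _ ⟨t, ht, rfl⟩
    have hint := ((soForm K q).mem_sIntegralPoints_empty t).1 ht
    obtain ⟨x, y, h, e⟩ := mem_soForm.1 t.2
    have hx : IsIntegral ℤ x := by simpa [e, rotation, rotationMatrix] using hint 0 0
    have hy : IsIntegral ℤ y := by simpa [e, rotation, rotationMatrix] using hint 1 0
    obtain ⟨α, hα, β, -, H'⟩ := exists_boundedIntegers hq hK hx hy h
    simp only [Set.mem_iUnion]
    refine ⟨_, ⟨α, hα, rfl⟩, ?_⟩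
    have e' : ∀ j l, (((soForm K q).diagInfty t v₀).1).1 j l = algebraMap K v₀.Completion (t.1.1 j l) :=
      fun j l => rfl
    change eval _ (f - C _) = 0
    rw [map_sub, eval_C, hf _ (v₀.embedding x) (v₀.embedding y), ← (H' v₀.embedding).1]
    · exact sub_self _
    · rw [e', InfinitePlace.extensionEmbedding_algebraMap, e]
      rfl
    · rw [e', InfinitePlace.extensionEmbedding_algebraMap, e]
      rfl
  simp only [Set.mem_iUnion] at hg
  obtain ⟨c, hc, hgc⟩ := hg
  change eval _ (f - C _) = 0 at hgc
  rw [map_sub, eval_C, hf g a b (v₀.extensionEmbedding_realHom a) (v₀.extensionEmbedding_realHom b),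
    sub_eq_zero] at hgc
  apply hF
  rw [← hgc] at hc
  convert hc using 1
  simp [pow_two]

theorem motionGroup_GoS_lt_Gs (hq : 2 ≤ q) (hsq : ∀ r : K, r ^ 2 ≠ -q)
    (hK : ∀ x : K, ∃ y : K, ∀ φ : K →+* ℂ, φ y = starRingEnd ℂ (φ x)) :
    (motionGroup K q).GoS ∅ < (motionGroup K q).Gs ∅ := by
  refine lt_of_le_of_ne inf_le_left fun heq => ?_
  let v₀ : InfinitePlace K := Classical.choice inferInstance
  obtain ⟨a, b, hab, hF⟩ := exists_real_norm_one_notMem (q := q) (by omega) (boundedReals_finite v₀)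
  let t : (motionGroup K q).Infty := fun v =>
    ⟨motion (v.realHom a) (v.realHom b) 0 0 (map_norm v.realHom hab),
      mem_motionGroup.2 ⟨_, _, _, _, _, rfl⟩⟩
  let x : (motionGroup K q).SPoints ∅ := (t, 1)
  have hx : x ∈ (motionGroup K q).Gs ∅ := fun χ hχ => by
    have h : ∀ v : InfinitePlace K, MvPolynomial.aeval (entries (x.1 v).1.1) χ = 1 := fun v =>
      aeval_character_rotation (by omega) hsq hχ v.Completion _ _ (map_norm v.realHom hab)
    simp [LinAlgGroup.charNorm, h]
  rw [← heq] at hx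
  have hx := hx.2
  -- The orbit of the standard real form is used, rather than all `realForm q α β` with bounded `α`,
  -- `β`, because integral points permute it by construction.
  let 𝒲 : Set (Submodule ℝ (motionGroup K q).lieInfty) :=
    Set.range fun g : (motionGroup K q).sIntegralPoints ∅ =>
      (realForm q 1 0).map ((motionGroup K q).Ad ((motionGroup K q).diagInfty g.1))
  have h𝒲' : ∀ W ∈ 𝒲, ∃ α ∈ boundedIntegers K, ∃ β ∈ boundedIntegers K, realForm q α β = W := by
    rintro _ ⟨⟨g, hg⟩, rfl⟩
    have hint := ((motionGroup K q).mem_sIntegralPoints_empty g).1 hg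
    obtain ⟨a, b, c, d, h, e⟩ := mem_motionGroup.1 g.2
    have ha : IsIntegral ℤ a := by simpa [e, motion, motionMatrix] using hint 0 0
    have hb : IsIntegral ℤ b := by simpa [e, motion, motionMatrix] using hint 1 0
    obtain ⟨α, hα, β, hβ, H⟩ := exists_boundedIntegers hq hK ha hb h
    exact ⟨α, hα, β, hβ, (map_Ad_realForm h e (fun φ => (H φ).1) fun φ => (H φ).2).symm⟩
  have h𝒲 : 𝒲.Finite := by
    refine (((boundedIntegers_finite K).prod (boundedIntegers_finite K)).image
      fun ab => realForm q ab.1 ab.2).subset fun W hW => ?_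
    obtain ⟨α, hα, β, hβ, rfl⟩ := h𝒲' W hW
    exact ⟨(α, β), ⟨hα, hβ⟩, rfl⟩
  have h1 : realForm q 1 0 ∈ 𝒲 := ⟨1, by simp [Module.End.one_eq_id]⟩
  have hmem := map_mem_of_mem_almostZariskiClosure
    (Module.finBasis ℝ (motionGroup K q).lieInfty) h𝒲 (A := ((motionGroup K q).sIntegralPoints ∅).map
      ((motionGroup K q).AdMatrix.comp (motionGroup K q).diagInfty)) (by
    rintro _ ⟨g, hg, rfl⟩ _ ⟨g', rfl⟩
    refine ⟨⟨g, hg⟩ * g', ?_⟩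
    change _ = Submodule.map (glAction _ ((motionGroup K q).AdMatrix ((motionGroup K q).diagInfty g))) _
    rw [glAction_AdMatrix, ← Submodule.map_comp, ← Module.End.mul_eq_comp, ← map_mul, ← map_mul]
    rfl) hx h1
  change Submodule.map (glAction _ ((motionGroup K q).AdMatrix t)) _ ∈ 𝒲 at hmem
  rw [glAction_AdMatrix] at hmem
  obtain ⟨α, hα, β, hβ, hW⟩ := h𝒲' _ hmem
  -- The image `(a, b)` of the single vector `(1, 0)` determines `α`: eliminating `β` from the two
  -- equations of the real form leaves `α = a² - q b²`, a value excluded by the choice of `a`, `b`.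
  let E : (motionGroup K q).lieInfty :=
    ⟨fun v => translationMatrix 1 0, fun v => translationMatrix_mem_lieAlg 1 0⟩
  have hE : E ∈ realForm q (1 : K) 0 := fun v => ⟨1, 0, rfl, by simp, by simp⟩
  have hE' : (motionGroup K q).Ad t E ∈ realForm q α β := by
    rw [hW]
    exact Submodule.mem_map_of_mem hE
  obtain ⟨y, z, hyz, h2, h3⟩ := hE' v₀
  rw [Ad_apply_translation (X := E) (v := v₀) (x := 1) (y := 0) (g := t)
    (h := map_norm v₀.realHom hab) rfl rfl] at hyz
  have hy : v₀.realHom a = y := by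
    simpa [translationMatrix] using congrFun (congrFun hyz 0) 2
  have hz : v₀.realHom b = z := by
    simpa [translationMatrix] using congrFun (congrFun hyz 1) 2
  rw [← hy, ← hz, InfinitePlace.extensionEmbedding_realHom,
    InfinitePlace.extensionEmbedding_realHom, Complex.conj_ofReal, Complex.conj_ofReal] at h2 h3
  have hab' : (a : ℂ) ^ 2 + q * (b : ℂ) ^ 2 = 1 := by exact_mod_cast hab
  have h4 : v₀.embedding α = ((a ^ 2 - q * b ^ 2 : ℝ) : ℂ) := by
    push_cast
    linear_combination -v₀.embedding α * hab' - a * h2 + q * b * h3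
  exact hF ⟨α, hα, by simp only [h4, Complex.ofReal_re]⟩

end SOForm

theorem mainTheorem12 (p q : ℕ) (hp : p.Prime) (hq : q.Prime) (hpq : p ≠ q) (hq4 : q % 4 = 3)
    (K : Type u) [Field K] [NumberField K] (i s : K) (hi : i ^ 2 = -1) (hs : s ^ 2 = (p : K))
    (hK : IntermediateField.adjoin ℚ {i, s} = ⊤) :
    (soForm K q).IsTorus ∧ (soForm K q).IsAnisotropic ∧
    ¬ (soForm K q).IsZariskiDenseInfty ∅ ∧
    ∃ (n : ℕ) (G T U : LinAlgGroup K n),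
      G.IsConnected ∧ G.IsSemidirect T U ∧ T.IsIsomorphic (soForm K q) ∧ U.IsUnipotent ∧
      T.TrivialCentralizer U ∧
      G.IsZariskiDense ∅ ∧ G.GoS ∅ < G.Gs ∅ := by
  have hsq := sq_ne_neg_prime hp hq hpq hi hs hK
  have hconj := exists_eq_conj hi hs hK
  exact ⟨SOForm.soForm_isTorus hq.ne_zero, SOForm.soForm_isAnisotropic hq.ne_zero hsq,
    SOForm.soForm_not_isZariskiDenseInfty hq.two_le hconj, 3, SOForm.motionGroup K q,
    SOForm.rotationGroup K q, SOForm.translationGroup K q,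
    SOForm.motionGroup_isConnected hq.ne_zero, SOForm.isSemidirect, SOForm.isIsomorphic,
    SOForm.isUnipotent, SOForm.trivialCentralizer, SOForm.motionGroup_isZariskiDense hq hi,
    SOForm.motionGroup_GoS_lt_Gs hq.two_le hsq hconj⟩
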